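/- Let $d\ge 2$ and let $\Omega\subset\mathbb R^d$ be a bounded Lipschitz domain (connected open set). Let $\Gamma,\tilde\Gamma\subset\partial\Omega$ be nonempty, disjoint and relatively open in $\partial\Omega$, with $\partial\Omega=\overline\Gamma\cup\overline{\tilde\Gamma}$. Put $V_0=\{v\in H^1(\Omega): v|_\Gamma=0\}$ and $\tilde V_0=\{\mu\in H^1(\Omega):\mu|_{\tilde\Gamma}=0\}$, in the sense of traces. For $f\in L^2(\Omega)$ and $\varepsilon>0$, let $(u_\varepsilon,\lambda_\varepsilon)\in V_0\times\tilde V_0$ be the solution of the quasi-reversibility problem: for all $(v,\mu)\in V_0\times\tilde V_0$, $$\varepsilon\int_\Omega\nabla u_\varepsilon\cdot\nabla v\,dx+\int_\Omega\nabla v\cdot\nabla\lambda_\varepsilon\,dx=0,\qquad \int_\Omega\nabla u_\varepsilon\cdot\nabla\mu\,dx-\int_\Omega\nabla\lambda_\varepsilon\cdot\nabla\mu\,dx=\int_\Omega f\mu\,dx .$$ Let $\zeta\in C_0^\infty(\Omega)$. Then $\zeta u_\varepsilon$ and $\zeta\lambda_\varepsilon$ belong to $H^2(\Omega)$ for all $f\in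 L^2(\Omega)$ and $\varepsilon>0$, and there is a constant $C>0$, depending only on $\Omega,\Gamma,\tilde\Gamma$ and $\zeta$, such that for all $f\in L^2(\Omega)$: 1. For all $\varepsilon\in(0,1]$, $$\sqrt\varepsilon\,\|\zeta u_\varepsilon\|_{H^2(\Omega)}+\|\zeta\lambda_\varepsilon\|_{H^2(\Omega)}\le C\|f\|_{L^2(\Omega)}.$$ 2. If in addition there is a solution $u\in H^1(\Omega)$ of the Cauchy problem $-\Delta u=f$ in $\Omega$ (in the sense of distributions), $u=0$ on $\Gamma$ (trace), $\partial_\nu u=0$ on $\Gamma$, then for all $\varepsilon\in(0,1]$, $$\|\zeta u_\varepsilon\|_{H^2(\Omega)}+\frac{\|\zeta\lambda_\varepsilon\|_{H^2(\Omega)}}{\sqrt\varepsilon}\le C\|u\|_{H^1(\Delta,\Omega)},\qquad \|u\|_{H^1(\Delta,\Omega)}^2=\|u\|_{H^1(\Omega)}^2+\|\Delta u\|_{L^2(\Omega)}^2 .$$ Here $\partial_\nu u=0$ on $\Gamma$ means that $\langle\partial_\nu u,\mu\rangle:=\int_\Omega\nabla u\cdot\nabla\mu\,dx+\int_\Omega\mu\,\Delta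 u\,dx$ vanishes for all $\mu\in\tilde V_0$. -/

import Mathlib

open MeasureTheory Set Filter Topology
open scoped ContDiff

namespace QuasiRev

/-- The Euclidean space `ℝ^d`. -/
abbrev Eu (d : ℕ) : Type := EuclideanSpace ℝ (Fin d)

variable {d : ℕ}

/-! ### The geometry -/

/-- Bounded Lipschitz domain: a nonempty, bounded, connected open set which, near every boundary
point and in suitable orthonormal coordinates, is the set of points lying strictly below the graph
of a Lipschitz function. Here `e` is the vertical direction and `y - ⟪e, y⟫ e` is the orthogonal
projection of `y` onto the horizontal hyperplane. -/
structure IsLipschitzDomain (Ω : Set (Eu d)) : Prop where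
  isOpen : IsOpen Ω
  isConnected : IsConnected Ω
  isBounded : Bornology.IsBounded Ω
  graph : ∀ x ∈ frontier Ω, ∃ (e : Eu d) (γ : Eu d → ℝ) (K : NNReal) (r : ℝ),
    ‖e‖ = 1 ∧ LipschitzWith K γ ∧ 0 < r ∧
      ∀ y ∈ Metric.ball x r, (y ∈ Ω ↔ inner ℝ e y < γ (y - (inner ℝ e y : ℝ) • e))

/-- `Γ` and `Γ'` are nonempty disjoint relatively open subsets of `∂Ω` whose closures cover
`∂Ω`. -/
structure IsBoundaryPartition (Ω Γ Γ' : Set (Eu d)) : Prop where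
  relOpen_left : ∃ U : Set (Eu d), IsOpen U ∧ Γ = U ∩ frontier Ω
  relOpen_right : ∃ U : Set (Eu d), IsOpen U ∧ Γ' = U ∩ frontier Ω
  nonempty_left : Γ.Nonempty
  nonempty_right : Γ'.Nonempty
  disjoint : Disjoint Γ Γ'
  cover : frontier Ω = closure Γ ∪ closure Γ'

/-! ### Test functions, weak derivatives -/

/-- `φ ∈ C_0^∞(Ω)`. -/
structure IsTestFun (Ω : Set (Eu d)) (φ : Eu d → ℝ) : Prop where
  smooth : ContDiff ℝ ∞ φ
  compact : HasCompactSupport φ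
  support : tsupport φ ⊆ Ω

/-- The classical partial derivative `∂_i φ`. -/
noncomputable def partialD (i : Fin d) (φ : Eu d → ℝ) : Eu d → ℝ :=
  fun x => fderiv ℝ φ x (EuclideanSpace.single i 1)

/-- `v ∈ L²(Ω)`. -/
def MemL2 (Ω : Set (Eu d)) (v : Eu d → ℝ) : Prop :=
  MemLp v 2 (volume.restrict Ω)

/-- `g` is the weak partial derivative `∂_i v` in `Ω`. -/
def HasWeakPartial (Ω : Set (Eu d)) (i : Fin d) (v g : Eu d → ℝ) : Prop :=
  ∀ φ, IsTestFun Ω φ → ∫ x in Ω, v x * partialD i φ x = -∫ x in Ω, g x * φ x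

/-- `g` is the distributional Laplacian `Δv` in `Ω`. -/
def HasWeakLaplacian (Ω : Set (Eu d)) (v g : Eu d → ℝ) : Prop :=
  ∀ φ, IsTestFun Ω φ →
    ∫ x in Ω, v x * (∑ i : Fin d, partialD i (partialD i φ) x) = ∫ x in Ω, g x * φ x

open Classical in
/-- A representative of the weak partial derivative `∂_i v`, when it exists in `L²(Ω)` (it is then
unique up to a null set of `Ω`); zero otherwise. -/
noncomputable def weakPartial (Ω : Set (Eu d)) (i : Fin d) (v : Eu d → ℝ) : Eu d → ℝ :=
  if h : ∃ g, MemL2 Ω g ∧ HasWeakPartial Ω i v g then h.choose else 0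

open Classical in
/-- A representative of the distributional Laplacian `Δv`, when it exists in `L²(Ω)` (it is then
unique up to a null set of `Ω`); zero otherwise. -/
noncomputable def weakLaplacian (Ω : Set (Eu d)) (v : Eu d → ℝ) : Eu d → ℝ :=
  if h : ∃ g, MemL2 Ω g ∧ HasWeakLaplacian Ω v g then h.choose else 0

/-! ### Sobolev spaces and norms -/

/-- `v ∈ H¹(Ω)`. -/
def MemH1 (Ω : Set (Eu d)) (v : Eu d → ℝ) : Prop :=
  MemL2 Ω v ∧ ∀ i : Fin d, ∃ g, MemL2 Ω g ∧ HasWeakPartial Ω i v g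

/-- `v ∈ H²(Ω)`: `v ∈ H¹(Ω)` and all first weak derivatives are in `H¹(Ω)`. -/
def MemH2 (Ω : Set (Eu d)) (v : Eu d → ℝ) : Prop :=
  MemH1 Ω v ∧ ∀ i : Fin d, MemH1 Ω (weakPartial Ω i v)

/-- `‖v‖_{L²(Ω)}`. -/
noncomputable def normL2 (Ω : Set (Eu d)) (v : Eu d → ℝ) : ℝ :=
  √(∫ x in Ω, v x ^ 2)

/-- `‖v‖_{H¹(Ω)}`. -/
noncomputable def normH1 (Ω : Set (Eu d)) (v : Eu d → ℝ) : ℝ :=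
  √(normL2 Ω v ^ 2 + ∑ i : Fin d, normL2 Ω (weakPartial Ω i v) ^ 2)

/-- `‖v‖_{H²(Ω)}`. -/
noncomputable def normH2 (Ω : Set (Eu d)) (v : Eu d → ℝ) : ℝ :=
  √(normL2 Ω v ^ 2 + (∑ i : Fin d, normL2 Ω (weakPartial Ω i v) ^ 2) +
    ∑ i : Fin d, ∑ j : Fin d, normL2 Ω (weakPartial Ω j (weakPartial Ω i v)) ^ 2)

/-- `‖v‖_{H¹(Δ,Ω)}`, where `‖v‖²_{H¹(Δ,Ω)} = ‖v‖²_{H¹(Ω)} + ‖Δv‖²_{L²(Ω)}`. -/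
noncomputable def normH1Delta (Ω : Set (Eu d)) (v : Eu d → ℝ) : ℝ :=
  √(normH1 Ω v ^ 2 + normL2 Ω (weakLaplacian Ω v) ^ 2)

/-- The Dirichlet form `∫_Ω ∇v · ∇w dx`. -/
noncomputable def dirichlet (Ω : Set (Eu d)) (v w : Eu d → ℝ) : ℝ :=
  ∫ x in Ω, ∑ i : Fin d, weakPartial Ω i v x * weakPartial Ω i w x

/-! ### Traces -/

/-- The trace of `v ∈ H¹(Ω)` on the boundary part `S` is `g`: `v` is a limit in `H¹(Ω)` of
restrictions to `Ω` of smooth functions `φ n` on `ℝ^d` whose restrictions to `S` converge to `g`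
in `L²(S)` for the surface measure, that is, the `(d-1)`-dimensional Hausdorff measure. -/
def HasTraceOn (Ω S : Set (Eu d)) (v g : Eu d → ℝ) : Prop :=
  ∃ φ : ℕ → Eu d → ℝ, (∀ n, ContDiff ℝ ∞ (φ n)) ∧
    Tendsto (fun n => normH1 Ω (fun x => φ n x - v x)) atTop (𝓝 0) ∧
    Tendsto (fun n => eLpNorm (fun x => φ n x - g x) 2
      ((Measure.hausdorffMeasure ((d : ℝ) - 1)).restrict S)) atTop (𝓝 0)

/-- `{v ∈ H¹(Ω) : v = 0 on S}` in the sense of traces, for a part `S` of `∂Ω`. This is `V_0` for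
`S = Γ`, and the second space `Ṽ_0` for the other part of the boundary. -/
def MemV0 (Ω S : Set (Eu d)) (v : Eu d → ℝ) : Prop :=
  MemH1 Ω v ∧ HasTraceOn Ω S v (fun _ => 0)

/-- The pairing `⟨∂_ν v, μ⟩` of the normal derivative of `v ∈ H¹(Ω)`, `Δv ∈ L²(Ω)`, with (the trace
of) `μ ∈ H¹(Ω)`, defined by Green's formula. -/
noncomputable def normalDerivPairing (Ω : Set (Eu d)) (v μ : Eu d → ℝ) : ℝ :=
  dirichlet Ω v μ + ∫ x in Ω, weakLaplacian Ω v x * μ x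

/-! ### The two problems -/

/-- The mixed formulation of quasi-reversibility with data `f` and parameter `ε`:
`(u, l) ∈ V_0 × Ṽ_0` and the two variational equations hold. -/
structure IsQRSolution (Ω Γ Γ' : Set (Eu d)) (f : Eu d → ℝ) (ε : ℝ) (u l : Eu d → ℝ) : Prop where
  mem_left : MemV0 Ω Γ u
  mem_right : MemV0 Ω Γ' l
  eq_left : ∀ v, MemV0 Ω Γ v → ε * dirichlet Ω u v + dirichlet Ω v l = 0
  eq_right : ∀ μ, MemV0 Ω Γ' μ → dirichlet Ω u μ - dirichlet Ω l μ = ∫ x in Ω, f x * μ x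

/-- `u ∈ H¹(Ω)` solves the Cauchy problem `-Δu = f` in `Ω`, `u = 0` and `∂_ν u = 0` on `Γ`. The last
condition, in the dual of the space of traces on `Γ` of functions that vanish on `Γ'`, says that the
normal derivative pairs to zero with every element of `Ṽ_0`. -/
structure IsCauchySolution (Ω Γ Γ' : Set (Eu d)) (f u : Eu d → ℝ) : Prop where
  memH1 : MemH1 Ω u
  laplace : HasWeakLaplacian Ω u (fun x => -f x)
  trace_zero : HasTraceOn Ω Γ u (fun _ => 0)
  normal_zero : ∀ μ, MemV0 Ω Γ' μ → normalDerivPairing Ω u μ = 0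

end QuasiRev

namespace QuasiRev
variable {d : ℕ}

/-! ### Test functions -/

/-! In the interior the two equations decouple. A test function belongs to both `V_0` and `Ṽ_0`, and
adding the two variational equations gives `(1 + ε) ∫ ∇u_ε · ∇φ = ∫ f φ`. Hence `Δu_ε = -f / (1 +
ε)` and `Δλ_ε = ε f / (1 + ε)`, so both Laplacians are in `L²`, the second with an additional factor
`ε`.

Interior regularity (`exists_interior_regularity`) bounds `‖ζ w‖²_{H²}` by `‖w‖² + ‖∇w‖² + ‖Δw‖²`.
After extension by zero, `ζ w` is a function on the whole space with Laplacian in `L²`, and `(1 - c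
Δ)⁻¹` followed by two derivatives is bounded on `L²`. Friedrichs' inequality
(`IsLipschitzDomain.exists_friedrichs`), applied on `Γ` to `u_ε` and on `Γ'` to `λ_ε`, removes the
zeroth order terms, so only gradient bounds are left.

These are energy estimates. Testing with `(u_ε, λ_ε)` gives `ε ‖∇u_ε‖² + ‖∇λ_ε‖² = -∫ f λ_ε`, from
which the first bound follows (`energy_le`). If the Cauchy problem has a solution `u`, its weak
Neumann condition turns `∫ f λ_ε` into `∫ ∇u · ∇λ_ε`, and the first equation tested with `u` turns
this into `-ε ∫ ∇u_ε · ∇u`. Every remaining term then carries a factor `ε` or is `‖∇λ_ε‖²`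
(`energy_le_of_cauchy`), which improves both bounds by `√ε`.

Friedrichs' inequality is proved without a trace operator. Smooth functions are integrated along
segments: from the boundary part into the domain, then through the domain by connectedness, and up
to the closure by compactness. The estimate passes to the limit along the sequences that define
vanishing traces. -/

theorem partialD_contDiff {φ : Eu d → ℝ} (hφ : ContDiff ℝ ∞ φ) (i : Fin d) :
    ContDiff ℝ ∞ (partialD i φ) := by
  unfold partialD
  exact (hφ.fderiv_right (m := ∞) (by simp)).clm_apply contDiff_const

theorem tsupport_partialD_subset (φ : Eu d → ℝ) (i : Fin d) :
    tsupport (partialD i φ) ⊆ tsupport φ := by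
  refine closure_minimal (fun x hx => ?_) (isClosed_tsupport φ)
  by_contra h
  refine hx ?_
  have h1 : fderiv ℝ φ x = 0 := by
    by_contra h2
    exact h (support_fderiv_subset ℝ h2)
  simp [partialD, h1]

theorem partialD_mul {φ ψ : Eu d → ℝ} (hφ : ContDiff ℝ ∞ φ) (hψ : ContDiff ℝ ∞ ψ) (i : Fin d)
    (x : Eu d) : partialD i (fun x => φ x * ψ x) x = partialD i φ x * ψ x + φ x * partialD i ψ x := by
  unfold partialD
  rw [fderiv_fun_mul (hφ.differentiable (by simp) x) (hψ.differentiable (by simp) x)]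
  simp
  ring

namespace IsTestFun

variable {Ω : Set (Eu d)} {φ ψ : Eu d → ℝ}

theorem partialD (hφ : IsTestFun Ω φ) (i : Fin d) : IsTestFun Ω (partialD i φ) where
  smooth := partialD_contDiff hφ.smooth i
  compact := hφ.compact.mono' ((subset_tsupport _).trans (tsupport_partialD_subset φ i))
  support := (tsupport_partialD_subset φ i).trans hφ.support

theorem mul_left (hφ : IsTestFun Ω φ) (hψ : ContDiff ℝ ∞ ψ) :
    IsTestFun Ω (fun x => ψ x * φ x) where
  smooth := hψ.mul hφ.smooth
  compact := hφ.compact.mul_left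
  support := (tsupport_mul_subset_right (f := ψ)).trans hφ.support

theorem mul_right (hφ : IsTestFun Ω φ) (hψ : ContDiff ℝ ∞ ψ) :
    IsTestFun Ω (fun x => φ x * ψ x) where
  smooth := hφ.smooth.mul hψ
  compact := hφ.compact.mul_right
  support := (tsupport_mul_subset_left (f := φ)).trans hφ.support

theorem eq_zero_of_notMem (hφ : IsTestFun Ω φ) {x : Eu d} (hx : x ∉ Ω) : φ x = 0 :=
  image_eq_zero_of_notMem_tsupport fun h => hx (hφ.support h)

theorem memLp (hφ : IsTestFun Ω φ) (p : ENNReal) (μ : Measure (Eu d))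
    [IsFiniteMeasureOnCompacts μ] : MemLp φ p μ :=
  hφ.smooth.continuous.memLp_of_hasCompactSupport hφ.compact

end IsTestFun

/-! ### Square integrable functions -/

section L2

variable {Ω : Set (Eu d)} {v w g h : Eu d → ℝ}

theorem MemL2.integrable_mul (hv : MemL2 Ω v) (hw : MemL2 Ω w) :
    Integrable (fun x => v x * w x) (volume.restrict Ω) :=
  MemLp.integrable_mul (p := 2) (q := 2) hv hw

theorem MemL2.integrable_sq (hv : MemL2 Ω v) :
    Integrable (fun x => v x ^ 2) (volume.restrict Ω) := MemLp.integrable_sq hv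

theorem MemL2.add (hv : MemL2 Ω v) (hw : MemL2 Ω w) : MemL2 Ω (fun x => v x + w x) :=
  MemLp.add hv hw

theorem MemL2.sub (hv : MemL2 Ω v) (hw : MemL2 Ω w) : MemL2 Ω (fun x => v x - w x) :=
  MemLp.sub hv hw

theorem MemL2.const_mul (hv : MemL2 Ω v) (c : ℝ) : MemL2 Ω (fun x => c * v x) :=
  MemLp.const_mul hv c

theorem IsTestFun.memL2 {φ : Eu d → ℝ} (hφ : IsTestFun Ω φ) : MemL2 Ω φ :=
  hφ.memLp 2 _

theorem IsTestFun.mul_memL2 {φ : Eu d → ℝ} (hφ : IsTestFun Ω φ) (hv : MemL2 Ω v) :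
    MemL2 Ω (fun x => φ x * v x) :=
  MemLp.mul (p := ⊤) (q := 2) (r := 2) hv (hφ.memLp ⊤ _)

theorem memL2_of_continuous (hΩ : Bornology.IsBounded Ω) (hv : Continuous v) : MemL2 Ω v := by
  obtain ⟨R, hR⟩ := hΩ.subset_closedBall 0
  have hc : IsCompact (Metric.closedBall (0 : Eu d) R) := isCompact_closedBall _ _
  have h1 : MemLp v 2 (volume.restrict (Metric.closedBall (0 : Eu d) R)) := by
    obtain ⟨C, hC⟩ := hc.exists_bound_of_continuousOn hv.continuousOn
    have : IsFiniteMeasure (volume.restrict (Metric.closedBall (0 : Eu d) R)) :=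
      ⟨by simpa using hc.measure_lt_top⟩
    refine MemLp.of_bound hv.aestronglyMeasurable C ?_
    exact (ae_restrict_iff' measurableSet_closedBall).2 (ae_of_all _ hC)
  exact h1.mono_measure (Measure.restrict_mono hR le_rfl)

theorem normL2_nonneg (v : Eu d → ℝ) : 0 ≤ normL2 Ω v := Real.sqrt_nonneg _

theorem normL2_sq (v : Eu d → ℝ) : normL2 Ω v ^ 2 = ∫ x in Ω, v x ^ 2 :=
  Real.sq_sqrt (integral_nonneg fun _ => sq_nonneg _)

theorem normL2_congr (hvw : v =ᵐ[volume.restrict Ω] w) : normL2 Ω v = normL2 Ω w := by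
  unfold normL2
  congr 1
  exact integral_congr_ae (hvw.mono fun x hx => by simp only [hx])

theorem normL2_eq_toReal (hv : MemL2 Ω v) :
    normL2 Ω v = (eLpNorm v 2 (volume.restrict Ω)).toReal := by
  have h := hv.eLpNorm_eq_integral_rpow_norm (by norm_num) (by norm_num)
  rw [h, ENNReal.toReal_ofReal (by positivity), normL2, Real.sqrt_eq_rpow]
  simp

theorem lintegral_enorm_sq_eq (hv : MemL2 Ω v) :
    ∫⁻ x in Ω, ‖v x‖ₑ ^ 2 = ENNReal.ofReal (normL2 Ω v ^ 2) := by
  rw [normL2_sq, ofReal_integral_eq_lintegral_ofReal hv.integrable_sq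
    (ae_of_all _ fun _ => sq_nonneg _)]
  refine lintegral_congr fun x => ?_
  rw [← sq_abs, ENNReal.ofReal_pow (abs_nonneg _), Real.enorm_eq_ofReal_abs]

theorem normL2_sq_add_le (hv : MemL2 Ω v) (hw : MemL2 Ω w) :
    normL2 Ω (fun x => v x + w x) ^ 2 ≤ 2 * normL2 Ω v ^ 2 + 2 * normL2 Ω w ^ 2 := by
  simp only [normL2_sq]
  rw [← integral_const_mul, ← integral_const_mul, ← integral_add
    (hv.integrable_sq.const_mul _) (hw.integrable_sq.const_mul _)]
  refine integral_mono (hv.add hw).integrable_sq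
    ((hv.integrable_sq.const_mul _).add (hw.integrable_sq.const_mul _)) fun x => ?_
  dsimp only
  nlinarith [sq_nonneg (v x - w x)]

theorem normL2_const_mul_sq (c : ℝ) (v : Eu d → ℝ) :
    normL2 Ω (fun x => c * v x) ^ 2 = c ^ 2 * normL2 Ω v ^ 2 := by
  simp only [normL2_sq, mul_pow, integral_const_mul]

theorem IsTestFun.exists_normL2_mul_le {φ : Eu d → ℝ} (hφ : IsTestFun Ω φ) :
    ∃ C : ℝ, 0 ≤ C ∧ ∀ v, MemL2 Ω v → normL2 Ω (fun x => φ x * v x) ^ 2 ≤ C * normL2 Ω v ^ 2 := by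
  obtain ⟨K, hK⟩ := hφ.compact.exists_bound_of_continuous hφ.smooth.continuous
  refine ⟨K ^ 2, sq_nonneg _, fun v hv => ?_⟩
  rw [normL2_sq, normL2_sq, ← integral_const_mul]
  refine integral_mono (hφ.mul_memL2 hv).integrable_sq (hv.integrable_sq.const_mul _) fun x => ?_
  simp only [mul_pow]
  have h1 : φ x ^ 2 ≤ K ^ 2 := by
    rw [← sq_abs]
    exact pow_le_pow_left₀ (abs_nonneg _) (hK x) 2
  exact mul_le_mul_of_nonneg_right h1 (sq_nonneg _)

end L2

/-! ### Weak derivatives -/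

section Weak

variable {Ω : Set (Eu d)} {v w g h : Eu d → ℝ} {i : Fin d}

theorem MemL2.ae_eq_zero (hΩ : IsOpen Ω) (hg : MemL2 Ω g)
    (h : ∀ φ, IsTestFun Ω φ → ∫ x in Ω, g x * φ x = 0) : g =ᵐ[volume.restrict Ω] 0 := by
  have hl : LocallyIntegrableOn g Ω volume := by
    refine (locallyIntegrableOn_of_locallyIntegrable_restrict ?_)
    exact MemLp.locallyIntegrable hg (by norm_num)
  have := hΩ.ae_eq_zero_of_integral_contDiff_smul_eq_zero hl (fun φ h1 h2 h3 => ?_)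
  · exact (ae_restrict_iff' hΩ.measurableSet).2 this
  · have h4 : ∀ x, x ∉ Ω → φ x • g x = 0 := fun x hx => by
      rw [IsTestFun.eq_zero_of_notMem ⟨h1, h2, h3⟩ hx, zero_smul]
    rw [← setIntegral_eq_integral_of_forall_compl_eq_zero h4, ← h φ ⟨h1, h2, h3⟩]
    simp [mul_comm]

theorem MemL2.ae_eq (hΩ : IsOpen Ω) (hg : MemL2 Ω g) (hh : MemL2 Ω h)
    (H : ∀ φ, IsTestFun Ω φ → ∫ x in Ω, g x * φ x = ∫ x in Ω, h x * φ x) :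
    g =ᵐ[volume.restrict Ω] h := by
  have := (hg.sub hh).ae_eq_zero hΩ fun φ hφ => by
    simp only [sub_mul]
    rw [integral_sub (hg.integrable_mul hφ.memL2) (hh.integrable_mul hφ.memL2), H φ hφ, sub_self]
  filter_upwards [this] with x hx
  exact sub_eq_zero.1 hx

theorem HasWeakPartial.ae_eq (hΩ : IsOpen Ω) (hg : MemL2 Ω g) (hh : MemL2 Ω h)
    (h1 : HasWeakPartial Ω i v g) (h2 : HasWeakPartial Ω i v h) : g =ᵐ[volume.restrict Ω] h :=
  hg.ae_eq hΩ hh fun φ hφ => by linarith [h1 φ hφ, h2 φ hφ]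

theorem MemH1.weakPartial_spec (hv : MemH1 Ω v) (i : Fin d) :
    MemL2 Ω (weakPartial Ω i v) ∧ HasWeakPartial Ω i v (weakPartial Ω i v) := by
  have h := hv.2 i
  rw [weakPartial, dif_pos h]
  exact h.choose_spec

/-- `weakPartial` is an arbitrary choice; by uniqueness it can be replaced in every integral and
norm by an explicit square integrable weak derivative. -/
theorem HasWeakPartial.weakPartial_ae (hΩ : IsOpen Ω) (hg : MemL2 Ω g)
    (h1 : HasWeakPartial Ω i v g) : weakPartial Ω i v =ᵐ[volume.restrict Ω] g := by
  have h : ∃ g, MemL2 Ω g ∧ HasWeakPartial Ω i v g := ⟨g, hg, h1⟩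
  have h2 : MemL2 Ω (weakPartial Ω i v) ∧ HasWeakPartial Ω i v (weakPartial Ω i v) := by
    rw [weakPartial, dif_pos h]
    exact h.choose_spec
  exact HasWeakPartial.ae_eq hΩ h2.1 hg h2.2 h1

theorem HasWeakLaplacian.weakLaplacian_ae (hΩ : IsOpen Ω) (hg : MemL2 Ω g)
    (h1 : HasWeakLaplacian Ω v g) : weakLaplacian Ω v =ᵐ[volume.restrict Ω] g := by
  have h : ∃ g, MemL2 Ω g ∧ HasWeakLaplacian Ω v g := ⟨g, hg, h1⟩
  have h2 : MemL2 Ω (weakLaplacian Ω v) ∧ HasWeakLaplacian Ω v (weakLaplacian Ω v) := by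
    rw [weakLaplacian, dif_pos h]
    exact h.choose_spec
  exact h2.1.ae_eq hΩ hg fun φ hφ => (h2.2 φ hφ).symm.trans (h1 φ hφ)

theorem HasWeakPartial.sub (hv : MemL2 Ω v) (hw : MemL2 Ω w) (hg : MemL2 Ω g) (hh : MemL2 Ω h)
    (h1 : HasWeakPartial Ω i v g) (h2 : HasWeakPartial Ω i w h) :
    HasWeakPartial Ω i (fun x => v x - w x) (fun x => g x - h x) := fun φ hφ => by
  simp only [sub_mul]
  rw [integral_sub (hv.integrable_mul (hφ.partialD i).memL2)
    (hw.integrable_mul (hφ.partialD i).memL2),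
    integral_sub (hg.integrable_mul hφ.memL2) (hh.integrable_mul hφ.memL2), h1 φ hφ, h2 φ hφ]
  ring

/-- Both integrands vanish outside `Ω`, so the integration by parts takes place on the whole space
and the boundary plays no role. -/
theorem integral_mul_partialD {φ ψ : Eu d → ℝ} (hψ : ContDiff ℝ ∞ ψ) (hφ : IsTestFun Ω φ)
    (i : Fin d) : ∫ x in Ω, ψ x * partialD i φ x = -∫ x in Ω, partialD i ψ x * φ x := by
  have h1 : ∀ x, x ∉ Ω → ψ x * partialD i φ x = 0 := fun x hx => by
    rw [(hφ.partialD i).eq_zero_of_notMem hx, mul_zero]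
  have h2 : ∀ x, x ∉ Ω → partialD i ψ x * φ x = 0 := fun x hx => by
    rw [hφ.eq_zero_of_notMem hx, mul_zero]
  rw [setIntegral_eq_integral_of_forall_compl_eq_zero h1,
    setIntegral_eq_integral_of_forall_compl_eq_zero h2]
  exact integral_mul_fderiv_eq_neg_fderiv_mul_of_integrable
    (memLp_one_iff_integrable.1 ((hφ.mul_left (partialD_contDiff hψ i)).memLp 1 volume))
    (memLp_one_iff_integrable.1 (((hφ.partialD i).mul_left hψ).memLp 1 volume))
    (memLp_one_iff_integrable.1 ((hφ.mul_left hψ).memLp 1 volume))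
    (fun x _ => hψ.differentiable (by simp) x) (fun x _ => hφ.smooth.differentiable (by simp) x)

theorem hasWeakPartial_of_contDiff {ψ : Eu d → ℝ} (hψ : ContDiff ℝ ∞ ψ) (i : Fin d) :
    HasWeakPartial Ω i ψ (partialD i ψ) := fun _ hφ => integral_mul_partialD hψ hφ i

theorem memH1_of_contDiff (hΩ : Bornology.IsBounded Ω) {ψ : Eu d → ℝ} (hψ : ContDiff ℝ ∞ ψ) :
    MemH1 Ω ψ :=
  ⟨memL2_of_continuous hΩ hψ.continuous, fun i => ⟨_, memL2_of_continuous hΩ (partialD_contDiff hψ i).continuous,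
    hasWeakPartial_of_contDiff hψ i⟩⟩

theorem MemH1.sub (hv : MemH1 Ω v) (hw : MemH1 Ω w) : MemH1 Ω (fun x => v x - w x) :=
  ⟨hv.1.sub hw.1, fun i => by
    obtain ⟨g, hg, hg'⟩ := hv.2 i
    obtain ⟨h, hh, hh'⟩ := hw.2 i
    exact ⟨_, hg.sub hh, hg'.sub hv.1 hw.1 hg hh hh'⟩⟩

theorem weakPartial_sub_ae (hΩ : IsOpen Ω) (hv : MemH1 Ω v) (hw : MemH1 Ω w) (i : Fin d) :
    weakPartial Ω i (fun x => v x - w x) =ᵐ[volume.restrict Ω]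
      fun x => weakPartial Ω i v x - weakPartial Ω i w x := by
  obtain ⟨h1, h2⟩ := hv.weakPartial_spec i
  obtain ⟨h3, h4⟩ := hw.weakPartial_spec i
  exact (h2.sub hv.1 hw.1 h1 h3 h4).weakPartial_ae hΩ (h1.sub h3)

/-- The weak derivative of `v` is tested against `ζ φ`, and the product rule is applied to the
smooth factor only. -/
theorem HasWeakPartial.test_mul {ζ : Eu d → ℝ} (hζ : IsTestFun Ω ζ) (hv : MemL2 Ω v)
    (hg : MemL2 Ω g) (h1 : HasWeakPartial Ω i v g) :
    HasWeakPartial Ω i (fun x => ζ x * v x) (fun x => ζ x * g x + partialD i ζ x * v x) :=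
  fun φ hφ => by
  have h2 := h1 _ (hφ.mul_left hζ.smooth)
  simp only [partialD_mul hζ.smooth hφ.smooth] at h2
  have i1 : Integrable (fun x => v x * (partialD i ζ x * φ x)) (volume.restrict Ω) :=
    hv.integrable_mul (hφ.mul_left (partialD_contDiff hζ.smooth i)).memL2
  have i2 : Integrable (fun x => v x * (ζ x * partialD i φ x)) (volume.restrict Ω) :=
    hv.integrable_mul ((hφ.partialD i).mul_left hζ.smooth).memL2
  have i3 : Integrable (fun x => g x * (ζ x * φ x)) (volume.restrict Ω) :=
    hg.integrable_mul (hφ.mul_left hζ.smooth).memL2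
  simp only [mul_add] at h2
  rw [integral_add i1 i2] at h2
  have e1 : ∀ x, (ζ x * g x + partialD i ζ x * v x) * φ x =
    g x * (ζ x * φ x) + v x * (partialD i ζ x * φ x) := fun x => by ring
  have e2 : ∀ x, ζ x * v x * partialD i φ x = v x * (ζ x * partialD i φ x) := fun x => by ring
  simp only [e1, e2]
  rw [integral_add i3 i1]
  linarith

end Weak

/-! ### The Dirichlet form -/

section Dirichlet

variable {Ω : Set (Eu d)} {u v w : Eu d → ℝ}

theorem dirichlet_comm (v w : Eu d → ℝ) : dirichlet Ω v w = dirichlet Ω w v := by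
  simp only [dirichlet, mul_comm]

theorem MemH1.dirichlet_integrable (hv : MemH1 Ω v) (hw : MemH1 Ω w) :
    Integrable (fun x => ∑ i : Fin d, weakPartial Ω i v x * weakPartial Ω i w x)
      (volume.restrict Ω) :=
  integrable_finsetSum _ fun i _ =>
    (hv.weakPartial_spec i).1.integrable_mul (hw.weakPartial_spec i).1

theorem MemH1.dirichlet_eq_sum (hv : MemH1 Ω v) (hw : MemH1 Ω w) :
    dirichlet Ω v w = ∑ i : Fin d, ∫ x in Ω, weakPartial Ω i v x * weakPartial Ω i w x :=
  integral_finsetSum _ fun i _ =>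
    (hv.weakPartial_spec i).1.integrable_mul (hw.weakPartial_spec i).1

theorem MemH1.dirichlet_self (hv : MemH1 Ω v) :
    dirichlet Ω v v = ∑ i : Fin d, normL2 Ω (weakPartial Ω i v) ^ 2 := by
  rw [hv.dirichlet_eq_sum hv]
  simp only [normL2_sq]
  simp only [sq]

theorem dirichlet_self_nonneg (v : Eu d → ℝ) : 0 ≤ dirichlet Ω v v :=
  integral_nonneg fun _ => Finset.sum_nonneg fun _ _ => mul_self_nonneg _

theorem MemH1.two_mul_dirichlet_le (hv : MemH1 Ω v) (hw : MemH1 Ω w) :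
    2 * dirichlet Ω v w ≤ dirichlet Ω v v + dirichlet Ω w w := by
  unfold dirichlet
  rw [← integral_const_mul, ← integral_add (hv.dirichlet_integrable hv)
    (hw.dirichlet_integrable hw)]
  refine integral_mono ((hv.dirichlet_integrable hw).const_mul _)
    ((hv.dirichlet_integrable hv).add (hw.dirichlet_integrable hw)) fun x => ?_
  dsimp only
  rw [Finset.mul_sum, ← Finset.sum_add_distrib]
  exact Finset.sum_le_sum fun i _ => by
    nlinarith [sq_nonneg (weakPartial Ω i v x - weakPartial Ω i w x)]

theorem MemH1.normH1_sq (hv : MemH1 Ω v) :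
    normH1 Ω v ^ 2 = normL2 Ω v ^ 2 + dirichlet Ω v v := by
  rw [hv.dirichlet_self, normH1, Real.sq_sqrt (by positivity)]

theorem IsTestFun.memH1 {φ : Eu d → ℝ} (hφ : IsTestFun Ω φ) : MemH1 Ω φ :=
  ⟨hφ.memL2, fun i => ⟨_, (hφ.partialD i).memL2, hasWeakPartial_of_contDiff hφ.smooth i⟩⟩

/-- The Dirichlet form against a test function is the weak Laplacian. -/
theorem MemH1.integral_mul_laplacian (hΩ : IsOpen Ω) (hv : MemH1 Ω v) {φ : Eu d → ℝ}
    (hφ : IsTestFun Ω φ) :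
    ∫ x in Ω, v x * (∑ i : Fin d, partialD i (partialD i φ) x) = -dirichlet Ω v φ := by
  rw [hv.dirichlet_eq_sum hφ.memH1, ← Finset.sum_neg_distrib]
  simp only [Finset.mul_sum]
  rw [integral_finsetSum _ fun i _ => hv.1.integrable_mul ((hφ.partialD i).partialD i).memL2]
  refine Finset.sum_congr rfl fun i _ => ?_
  rw [(hv.weakPartial_spec i).2 _ (hφ.partialD i)]
  congr 1
  refine integral_congr_ae (((hasWeakPartial_of_contDiff hφ.smooth i).weakPartial_ae hΩ
    (hφ.partialD i).memL2).mono fun x hx => ?_)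
  simp only [hx]

end Dirichlet

/-! ### Hausdorff measure of projections -/

section Projection
open scoped NNReal ENNReal

theorem exists_orthonormalBasis_zero {n : ℕ} {e : Eu (n + 1)} (he : ‖e‖ = 1) :
    ∃ b : OrthonormalBasis (Fin (n + 1)) ℝ (Eu (n + 1)), b 0 = e := by
  obtain ⟨b, hb⟩ := Orthonormal.exists_orthonormalBasis_extension_of_card_eq (𝕜 := ℝ)
    (E := Eu (n + 1)) (ι := Fin (n + 1)) (by simp) (v := fun _ => e) (s := {0})
    ⟨fun _ => he, fun i j hij => (hij (Subsingleton.elim i j)).elim⟩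
  exact ⟨b, hb 0 rfl⟩

/-- A bounded cylinder over the projection of `F` along `e` has volume bounded by the
`(d-1)`-dimensional Hausdorff measure of `F`. -/
theorem exists_volume_cylinder_le (hd : 1 ≤ d) {e : Eu d} (he : ‖e‖ = 1) (x₀ : Eu d) (ρ : ℝ) :
    ∃ C : ℝ≥0, ∀ F : Set (Eu d),
      volume {y ∈ Metric.ball x₀ ρ | ∃ z ∈ F, y - (inner ℝ e y : ℝ) • e = z - (inner ℝ e z : ℝ) • e}
        ≤ C * Measure.hausdorffMeasure ((d : ℝ) - 1) F := by
  obtain ⟨n, rfl⟩ : ∃ n, d = n + 1 := ⟨d - 1, by omega⟩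
  obtain ⟨b, hb⟩ := exists_orthonormalBasis_zero he
  let Φ : Eu (n + 1) → (Fin n → ℝ) := fun y i => b.repr y i.succ
  have hΦe : ∀ (y : Eu (n + 1)) (c : ℝ), Φ (y - c • e) = Φ y := fun y c => by
    ext i
    have : b.repr e i.succ = 0 := by
      rw [← hb, b.repr_self]
      simp
    simp [Φ, this]
  have hΦ : LipschitzWith 1 Φ := LipschitzWith.mk_one fun x y => by
    refine (dist_pi_le_iff dist_nonneg).2 fun i => ?_
    rw [← b.repr.dist_map x y]
    simp only [Φ]
    rw [dist_eq_norm, dist_eq_norm]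
    exact PiLp.norm_apply_le (b.repr x - b.repr y) i.succ
  let f : Eu (n + 1) ≃ᵐ ℝ × (Fin n → ℝ) :=
    (b.measurableEquiv.trans (MeasurableEquiv.toLp 2 (Fin (n + 1) → ℝ)).symm).trans
      (MeasurableEquiv.piFinSuccAbove (fun _ => ℝ) 0)
  have hf : MeasurePreserving f volume volume :=
    (b.measurePreserving_measurableEquiv.trans
      (EuclideanSpace.volume_preserving_symm_measurableEquiv_toLp (Fin (n + 1)))).trans
      (volume_preserving_piFinSuccAbove (fun _ => ℝ) 0)
  have hfy : ∀ y, f y = (inner ℝ e y, Φ y) := fun y => by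
    refine Prod.ext ?_ ?_
    · rw [← hb, ← b.repr_apply_apply]
      rfl
    · rfl
  refine ⟨(2 * ρ).toNNReal, fun F => ?_⟩
  have hsub : {y ∈ Metric.ball x₀ ρ |
      ∃ z ∈ F, y - (inner ℝ e y : ℝ) • e = z - (inner ℝ e z : ℝ) • e} ⊆
      f ⁻¹' (Icc (inner ℝ e x₀ - ρ) (inner ℝ e x₀ + ρ) ×ˢ (Φ '' F)) := by
    rintro y ⟨hy, z, hz, hyz⟩
    rw [mem_preimage, hfy]
    refine ⟨?_, z, hz, ?_⟩
    · have h1 : |inner ℝ e y - inner ℝ e x₀| ≤ ρ := by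
        rw [← inner_sub_right]
        refine (abs_real_inner_le_norm _ _).trans ?_
        rw [he, one_mul, ← dist_eq_norm]
        exact (Metric.mem_ball.1 hy).le
      rw [abs_le] at h1
      exact ⟨by linarith, by linarith⟩
    · have := congrArg Φ hyz
      rwa [hΦe, hΦe, eq_comm] at this
  refine (measure_mono hsub).trans ?_
  rw [hf.measure_preimage_equiv]
  change (volume.prod volume) _ ≤ _
  rw [Measure.prod_prod, Real.volume_Icc]
  have h2 : inner ℝ e x₀ + ρ - (inner ℝ e x₀ - ρ) = 2 * ρ := by ring
  rw [h2]
  refine mul_le_mul_right ?_ _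
  -- In the sup norm on `ℝⁿ`, Lebesgue measure is exactly the Hausdorff measure, and `Φ` is
  -- 1-Lipschitz into that norm; the only constant is the height `2ρ` of the cylinder.
  have h3 : (volume : Measure (Fin n → ℝ)) = Measure.hausdorffMeasure (n : ℝ) := by
    rw [← hausdorffMeasure_pi_real, Fintype.card_fin]
  have h4 : ((n + 1 : ℕ) : ℝ) - 1 = n := by push_cast; ring
  rw [h3, h4]
  simpa using hΦ.hausdorffMeasure_image_le (Nat.cast_nonneg n) F

end Projection

/-! ### Integration along segments -/

section Segments
open scoped NNReal ENNReal

theorem lintegral_sq_le {α : Type*} [MeasurableSpace α] {μ : Measure α} {f : α → ℝ≥0∞}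
    (hf : AEMeasurable f μ) : (∫⁻ a, f a ∂μ) ^ 2 ≤ μ univ * ∫⁻ a, f a ^ 2 ∂μ := by
  have h := ENNReal.lintegral_mul_le_Lp_mul_Lq μ Real.HolderConjugate.two_two hf
    (aemeasurable_const (b := (1 : ℝ≥0∞)))
  simp only [Pi.mul_apply, mul_one, ENNReal.one_rpow, lintegral_const, one_mul] at h
  calc (∫⁻ a, f a ∂μ) ^ 2
      ≤ ((∫⁻ a, f a ^ (2 : ℝ) ∂μ) ^ (1 / 2 : ℝ) * μ univ ^ (1 / 2 : ℝ)) ^ 2 := by gcongr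
    _ = μ univ * ∫⁻ a, f a ^ 2 ∂μ := by
      rw [mul_pow, ← ENNReal.rpow_natCast, ← ENNReal.rpow_natCast, ← ENNReal.rpow_mul,
        ← ENNReal.rpow_mul]
      norm_num
      rw [mul_comm]

theorem enorm_sq_add_le (a b : ℝ) : ‖a + b‖ₑ ^ 2 ≤ 2 * ‖a‖ₑ ^ 2 + 2 * ‖b‖ₑ ^ 2 := by
  simp only [Real.enorm_eq_ofReal_abs]
  rw [← ENNReal.ofReal_pow (abs_nonneg _), ← ENNReal.ofReal_pow (abs_nonneg _),
    ← ENNReal.ofReal_pow (abs_nonneg _), sq_abs, sq_abs, sq_abs,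
    ← ENNReal.ofReal_ofNat 2, ← ENNReal.ofReal_mul (by norm_num),
    ← ENNReal.ofReal_mul (by norm_num), ← ENNReal.ofReal_add (by positivity) (by positivity)]
  exact ENNReal.ofReal_le_ofReal (by nlinarith [sq_nonneg (a - b)])

variable {Ω : Set (Eu d)}

/-- Fundamental theorem of calculus and Cauchy–Schwarz. The integral is enlarged to the fixed length
`s` with the indicator of `Ω`, so that Fubini and translation invariance apply even when `h` depends
on `y`. -/
theorem enorm_sq_le_along_segment {φ : Eu d → ℝ} (hφ : ContDiff ℝ ∞ φ) {y e : Eu d}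
    (he : ‖e‖ ≤ 1) {h s : ℝ} (h0 : 0 ≤ h) (hs : h ≤ s) (hseg : ∀ τ ∈ Ioo 0 h, y + τ • e ∈ Ω) :
    ‖φ y‖ₑ ^ 2 ≤ 2 * ‖φ (y + h • e)‖ₑ ^ 2 + 2 * (ENNReal.ofReal s *
      ∫⁻ τ in Ioo 0 s, Ω.indicator (fun x => ‖fderiv ℝ φ x‖ₑ ^ 2) (y + τ • e)) := by
  have hcd : Continuous (fderiv ℝ φ) := hφ.continuous_fderiv (by simp)
  have hline : Continuous fun τ : ℝ => y + τ • e := by fun_prop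
  have hder : ∀ τ, HasDerivAt (fun τ : ℝ => φ (y + τ • e)) (fderiv ℝ φ (y + τ • e) e) τ := by
    intro τ
    have h1 : HasDerivAt (fun τ : ℝ => y + τ • e) e τ := by
      simpa using ((hasDerivAt_id τ).smul_const e).const_add y
    exact ((hφ.differentiable (by simp)) _).hasFDerivAt.comp_hasDerivAt τ h1
  have hftc : ∫ τ in (0 : ℝ)..h, fderiv ℝ φ (y + τ • e) e = φ (y + h • e) - φ y := by
    rw [intervalIntegral.integral_eq_sub_of_hasDerivAt (fun τ _ => hder τ)
      (((hcd.comp hline).clm_apply continuous_const).intervalIntegrable _ _)]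
    simp
  have h1 : φ y = φ (y + h • e) + -∫ τ in (0 : ℝ)..h, fderiv ℝ φ (y + τ • e) e := by
    rw [hftc]; ring
  have h2 : ‖-∫ τ in (0 : ℝ)..h, fderiv ℝ φ (y + τ • e) e‖ₑ ≤
      ∫⁻ τ in Ioo 0 h, ‖fderiv ℝ φ (y + τ • e)‖ₑ := by
    rw [enorm_neg, intervalIntegral.integral_of_le h0]
    refine (enorm_integral_le_lintegral_enorm _).trans ?_
    rw [← setLIntegral_congr Ioo_ae_eq_Ioc]
    refine lintegral_mono fun τ => ?_
    refine (ContinuousLinearMap.le_opENorm _ _).trans ?_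
    calc ‖fderiv ℝ φ (y + τ • e)‖ₑ * ‖e‖ₑ ≤ ‖fderiv ℝ φ (y + τ • e)‖ₑ * 1 := by
          gcongr
          rw [← ofReal_norm]
          exact ENNReal.ofReal_le_one.2 he
      _ = _ := mul_one _
  have h3 : (∫⁻ τ in Ioo 0 h, ‖fderiv ℝ φ (y + τ • e)‖ₑ) ^ 2 ≤
      ENNReal.ofReal s * ∫⁻ τ in Ioo 0 s,
        Ω.indicator (fun x => ‖fderiv ℝ φ x‖ₑ ^ 2) (y + τ • e) := by
    refine (lintegral_sq_le (hcd.comp hline).enorm.measurable.aemeasurable).trans ?_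
    refine mul_le_mul' ?_ ?_
    · simp only [MeasurableSet.univ, Measure.restrict_apply, univ_inter, Real.volume_Ioo, sub_zero]
      exact ENNReal.ofReal_le_ofReal hs
    · calc ∫⁻ τ in Ioo 0 h, ‖fderiv ℝ φ (y + τ • e)‖ₑ ^ 2
          = ∫⁻ τ in Ioo 0 h, Ω.indicator (fun x => ‖fderiv ℝ φ x‖ₑ ^ 2) (y + τ • e) :=
            setLIntegral_congr_fun measurableSet_Ioo fun τ hτ => by
              simp only [indicator_of_mem (hseg τ hτ)]
        _ ≤ _ := lintegral_mono_set (Ioo_subset_Ioo_right hs)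
  rw [h1]
  refine (enorm_sq_add_le _ _).trans ?_
  gcongr
  exact (pow_le_pow_left₀ zero_le h2 2).trans h3

/-- After exchanging the integrals, each `τ` contributes at most the full gradient integral over
`Ω`, by translation invariance. It serves both for a constant length `h` (translations) and for the
distance to the graph (boundary points). -/
theorem setLIntegral_enorm_sq_le_along_segments (hΩ : MeasurableSet Ω) {A : Set (Eu d)}
    (hA : MeasurableSet A) {h : Eu d → ℝ} (hh : Measurable h) {e : Eu d} (he : ‖e‖ ≤ 1) {s : ℝ}
    (h0 : ∀ y ∈ A, 0 ≤ h y) (hs : ∀ y ∈ A, h y ≤ s)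
    (hseg : ∀ y ∈ A, ∀ τ ∈ Ioo 0 (h y), y + τ • e ∈ Ω) {φ : Eu d → ℝ} (hφ : ContDiff ℝ ∞ φ) :
    ∫⁻ y in A, ‖φ y‖ₑ ^ 2 ≤ 2 * (∫⁻ y in A, ‖φ (y + h y • e)‖ₑ ^ 2) +
      2 * (ENNReal.ofReal s * (ENNReal.ofReal s * ∫⁻ x in Ω, ‖fderiv ℝ φ x‖ₑ ^ 2)) := by
  have hcd : Continuous (fderiv ℝ φ) := hφ.continuous_fderiv (by simp)
  set q : Eu d → ℝ≥0∞ := Ω.indicator (fun x => ‖fderiv ℝ φ x‖ₑ ^ 2)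
  have hq : Measurable q := (hcd.enorm.measurable.pow_const 2).indicator hΩ
  have hq2 : Measurable fun p : Eu d × ℝ => q (p.1 + p.2 • e) :=
    hq.comp (by fun_prop : Continuous fun p : Eu d × ℝ => p.1 + p.2 • e).measurable
  have hm1 : Measurable fun y => 2 * ‖φ (y + h y • e)‖ₑ ^ 2 :=
    ((hφ.continuous.measurable.comp (measurable_id.add (hh.smul_const e))).enorm.pow_const
      2).const_mul 2
  have hswap : ∫⁻ y in A, ∫⁻ τ in Ioo 0 s, q (y + τ • e) ≤
      ENNReal.ofReal s * ∫⁻ x in Ω, ‖fderiv ℝ φ x‖ₑ ^ 2 := by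
    rw [lintegral_lintegral_swap hq2.aemeasurable]
    calc ∫⁻ τ in Ioo 0 s, ∫⁻ y in A, q (y + τ • e)
        ≤ ∫⁻ τ in Ioo 0 s, ∫⁻ x in Ω, ‖fderiv ℝ φ x‖ₑ ^ 2 := by
          refine lintegral_mono fun τ => ?_
          refine (setLIntegral_le_lintegral _ _).trans ?_
          rw [lintegral_add_right_eq_self q (τ • e), lintegral_indicator hΩ]
      _ = _ := by
        rw [lintegral_const, mul_comm]
        simp
  calc ∫⁻ y in A, ‖φ y‖ₑ ^ 2
      ≤ ∫⁻ y in A, (2 * ‖φ (y + h y • e)‖ₑ ^ 2 +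
          2 * (ENNReal.ofReal s * ∫⁻ τ in Ioo 0 s, q (y + τ • e))) :=
        setLIntegral_mono' hA fun y hy =>
          enorm_sq_le_along_segment hφ he (h0 y hy) (hs y hy) (hseg y hy)
    _ = 2 * (∫⁻ y in A, ‖φ (y + h y • e)‖ₑ ^ 2) +
          2 * (ENNReal.ofReal s * ∫⁻ y in A, ∫⁻ τ in Ioo 0 s, q (y + τ • e)) := by
        rw [lintegral_add_left hm1, lintegral_const_mul' _ _ (by simp),
          lintegral_const_mul' _ _ (by simp), lintegral_const_mul' _ _ (by simp)]
    _ ≤ _ := by gcongr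

end Segments

/-! ### Friedrichs' inequality by propagation of local bounds. -/

section Poincare
open scoped NNReal ENNReal

variable {Ω S N N' : Set (Eu d)}

/-- On `N ∩ Ω`, smooth functions are controlled in `L²` by their values on `S` and their gradient
on `Ω`. -/
def HasLocalBound (Ω S N : Set (Eu d)) : Prop :=
  ∃ C : ℝ≥0, ∀ φ : Eu d → ℝ, ContDiff ℝ ∞ φ →
    ∫⁻ x in N ∩ Ω, ‖φ x‖ₑ ^ 2 ≤
      C * ((∫⁻ x in S, ‖φ x‖ₑ ^ 2 ∂(Measure.hausdorffMeasure ((d : ℝ) - 1))) +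
        ∫⁻ x in Ω, ‖fderiv ℝ φ x‖ₑ ^ 2)

theorem HasLocalBound.mono (h : HasLocalBound Ω S N') (hN : N ⊆ N') : HasLocalBound Ω S N := by
  obtain ⟨C, hC⟩ := h
  exact ⟨C, fun φ hφ => (lintegral_mono_set (inter_subset_inter_left _ hN)).trans (hC φ hφ)⟩

theorem hasLocalBound_empty : HasLocalBound Ω S ∅ := ⟨0, fun φ _ => by simp⟩

theorem HasLocalBound.union (h : HasLocalBound Ω S N) (h' : HasLocalBound Ω S N') :
    HasLocalBound Ω S (N ∪ N') := by
  obtain ⟨C, hC⟩ := h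
  obtain ⟨C', hC'⟩ := h'
  refine ⟨C + C', fun φ hφ => ?_⟩
  rw [union_inter_distrib_right, ENNReal.coe_add, add_mul]
  exact (lintegral_union_le _ _ _).trans (add_le_add (hC φ hφ) (hC' φ hφ))

/-- A local bound propagates along a translation whose segments stay in `Ω`, at the cost of the
gradient integral over `Ω`. -/
theorem HasLocalBound.translate (hΩ : MeasurableSet Ω) (hN : MeasurableSet N)
    (hN' : MeasurableSet N') (h : HasLocalBound Ω S N') {e : Eu d} (he : ‖e‖ ≤ 1) {s : ℝ}
    (hs : 0 ≤ s) (hseg : ∀ y ∈ N ∩ Ω, ∀ τ ∈ Ioo 0 s, y + τ • e ∈ Ω)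
    (hend : ∀ y ∈ N ∩ Ω, y + s • e ∈ N' ∩ Ω) : HasLocalBound Ω S N := by
  obtain ⟨C, hC⟩ := h
  refine ⟨2 * C + 2 * (s.toNNReal * s.toNNReal), fun φ hφ => ?_⟩
  have h1 := setLIntegral_enorm_sq_le_along_segments hΩ (hN.inter hΩ) (h := fun _ => s)
    measurable_const he (fun _ _ => hs) (fun _ _ => le_rfl) hseg hφ
  have h2 : ∫⁻ y in N ∩ Ω, ‖φ (y + s • e)‖ₑ ^ 2 ≤ ∫⁻ y in N' ∩ Ω, ‖φ y‖ₑ ^ 2 := by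
    rw [← lintegral_indicator (hN.inter hΩ), ← lintegral_indicator (hN'.inter hΩ),
      ← lintegral_add_right_eq_self ((N' ∩ Ω).indicator fun y => ‖φ y‖ₑ ^ 2) (s • e)]
    refine lintegral_mono fun y => ?_
    by_cases hy : y ∈ N ∩ Ω
    · simp only [indicator_of_mem hy, indicator_of_mem (hend y hy), le_refl]
    · simp only [indicator_of_notMem hy, zero_le]
  refine h1.trans ?_
  set E := ∫⁻ x in Ω, ‖fderiv ℝ φ x‖ₑ ^ 2
  set T := ∫⁻ x in S, ‖φ x‖ₑ ^ 2 ∂(Measure.hausdorffMeasure ((d : ℝ) - 1))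
  have h3 : ENNReal.ofReal s = (s.toNNReal : ℝ≥0∞) := rfl
  push_cast
  rw [h3]
  calc 2 * (∫⁻ y in N ∩ Ω, ‖φ (y + s • e)‖ₑ ^ 2) +
        2 * ((s.toNNReal : ℝ≥0∞) * ((s.toNNReal : ℝ≥0∞) * E))
      ≤ 2 * (C * (T + E)) + 2 * ((s.toNNReal : ℝ≥0∞) * ((s.toNNReal : ℝ≥0∞) * (T + E))) := by
        gcongr
        · exact h2.trans (hC φ hφ)
        · exact le_add_self
    _ = _ := by ring

/-- A chart in which a set lies below the graph of a Lipschitz function. -/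
structure IsGraphChart (Ω : Set (Eu d)) (x e : Eu d) (γ : Eu d → ℝ) (r : ℝ) : Prop where
  norm_eq : ‖e‖ = 1
  continuous : Continuous γ
  pos : 0 < r
  mem_iff : ∀ y ∈ Metric.ball x r, (y ∈ Ω ↔ inner ℝ e y < γ (y - (inner ℝ e y : ℝ) • e))

namespace IsGraphChart

variable {x e : Eu d} {γ : Eu d → ℝ} {r : ℝ}

theorem inner_add_smul (h : IsGraphChart Ω x e γ r) (y : Eu d) (τ : ℝ) :
    inner ℝ e (y + τ • e) = inner ℝ e y + τ := by
  rw [inner_add_right, inner_smul_right, real_inner_self_eq_norm_sq, h.norm_eq]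
  ring

theorem proj_add_smul (h : IsGraphChart Ω x e γ r) (y : Eu d) (τ : ℝ) :
    y + τ • e - (inner ℝ e (y + τ • e) : ℝ) • e = y - (inner ℝ e y : ℝ) • e := by
  rw [h.inner_add_smul, add_smul]
  abel

theorem continuous_height (h : IsGraphChart Ω x e γ r) :
    Continuous fun y => γ (y - (inner ℝ e y : ℝ) • e) - inner ℝ e y :=
  (h.continuous.comp (by fun_prop)).sub (by fun_prop)

/-- The centre is not below the graph because the open set `Ω` misses its frontier; it is not above
because the centre is a limit of points of `Ω`, where the height is positive. -/
theorem height_eq_zero (h : IsGraphChart Ω x e γ r) (hΩ : IsOpen Ω) (hx : x ∈ frontier Ω) :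
    γ (x - (inner ℝ e x : ℝ) • e) - inner ℝ e x = 0 := by
  rw [hΩ.frontier_eq] at hx
  refine le_antisymm (sub_nonpos.2 (not_lt.1 fun h1 => hx.2 ?_)) ?_
  · exact (h.mem_iff x (Metric.mem_ball_self h.pos)).2 h1
  · have hx' : x ∈ closure (Ω ∩ Metric.ball x r) :=
      mem_closure_iff_nhds.2 fun t ht => by
        have := mem_closure_iff_nhds.1 hx.1 _ (inter_mem ht (Metric.ball_mem_nhds x h.pos))
        obtain ⟨y, ⟨hy1, hy2⟩, hy3⟩ := this
        exact ⟨y, hy1, hy3, hy2⟩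
    have hc : IsClosed {y | 0 ≤ γ (y - (inner ℝ e y : ℝ) • e) - inner ℝ e y} :=
      isClosed_Ici.preimage h.continuous_height
    exact closure_minimal (fun y hy => (sub_pos.2 ((h.mem_iff y hy.2).1 hy.1)).le) hc hx'

theorem add_smul_mem_iff (h : IsGraphChart Ω x e γ r) {y : Eu d} {τ : ℝ}
    (hy : y + τ • e ∈ Metric.ball x r) :
    y + τ • e ∈ Ω ↔ τ < γ (y - (inner ℝ e y : ℝ) • e) - inner ℝ e y := by
  rw [h.mem_iff _ hy, h.proj_add_smul, h.inner_add_smul]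
  constructor <;> intro h1 <;> linarith

theorem add_smul_mem_ball (h : IsGraphChart Ω x e γ r) {y : Eu d} {τ a b : ℝ}
    (hy : y ∈ Metric.ball x a) (hτ : |τ| ≤ b) : y + τ • e ∈ Metric.ball x (a + b) := by
  rw [Metric.mem_ball, dist_eq_norm] at hy ⊢
  have : y + τ • e - x = (y - x) + τ • e := by abel
  rw [this]
  refine (norm_add_le _ _).trans_lt ?_
  rw [norm_smul, h.norm_eq, mul_one, Real.norm_eq_abs]
  linarith

/-- The graph point is approached from below by points of `Ω` but is not itself in `Ω`. -/
theorem graph_mem_frontier (h : IsGraphChart Ω x e γ r) (hΩ : IsOpen Ω) {y : Eu d}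
    (hy : y + (γ (y - (inner ℝ e y : ℝ) • e) - inner ℝ e y) • e ∈ Metric.ball x r) :
    y + (γ (y - (inner ℝ e y : ℝ) • e) - inner ℝ e y) • e ∈ frontier Ω := by
  set t := γ (y - (inner ℝ e y : ℝ) • e) - inner ℝ e y
  rw [hΩ.frontier_eq]
  refine ⟨?_, fun hmem => lt_irrefl _ ((h.add_smul_mem_iff hy).1 hmem)⟩
  have hc : Continuous fun τ : ℝ => y + τ • e := by fun_prop
  have h1 : Tendsto (fun τ : ℝ => y + τ • e) (𝓝[<] t) (𝓝 (y + t • e)) :=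
    (hc.tendsto t).mono_left nhdsWithin_le_nhds
  refine mem_closure_of_tendsto h1 ?_
  filter_upwards [self_mem_nhdsWithin, h1.eventually (Metric.isOpen_ball.mem_nhds hy)] with τ hτ hb
  exact (h.add_smul_mem_iff hb).2 hτ

/-- Near a point of a relatively open part `U ∩ ∂Ω` of the boundary, functions are controlled by
their boundary values on this part and their gradient. -/
theorem exists_hasLocalBound (h : IsGraphChart Ω x e γ r) (hd : 1 ≤ d) (hΩ : IsOpen Ω)
    {U : Set (Eu d)} (hU : IsOpen U) (hx : x ∈ U ∩ frontier Ω) :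
    ∃ ρ > 0, HasLocalBound Ω (U ∩ frontier Ω) (Metric.ball x ρ) := by
  obtain ⟨ρ₀, hρ₀, hρU⟩ := Metric.isOpen_iff.1 hU x hx.1
  -- Half of the available radius: a point within `δ` of `x`, shifted by at most `δ`, stays both in
  -- the chart and in `U`.
  set δ := min r ρ₀ / 2
  have hr := h.pos
  have hδ : 0 < δ := by positivity
  have hδr : δ + δ ≤ r := by
    have := min_le_left r ρ₀; simp only [δ]; linarith
  have hδρ : δ + δ ≤ ρ₀ := by
    have := min_le_right r ρ₀; simp only [δ]; linarith
  set t : Eu d → ℝ := fun y => γ (y - (inner ℝ e y : ℝ) • e) - inner ℝ e y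
  have ht : Continuous t := h.continuous_height
  have htx : t x = 0 := h.height_eq_zero hΩ hx.2
  obtain ⟨ρ₁, hρ₁, hρt⟩ := Metric.continuous_iff.1 ht x δ hδ
  refine ⟨min ρ₁ δ, by positivity, ?_⟩
  set A := Metric.ball x (min ρ₁ δ) ∩ Ω
  have hA : MeasurableSet A := (Metric.isOpen_ball.inter hΩ).measurableSet
  have hAδ : ∀ y ∈ A, y ∈ Metric.ball x δ := fun y hy =>
    Metric.ball_subset_ball (min_le_right _ _) hy.1
  have htabs : ∀ y ∈ A, |t y| < δ := fun y hy => by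
    have := hρt y (Metric.ball_subset_ball (min_le_left _ _) hy.1)
    rwa [htx, Real.dist_eq, sub_zero] at this
  have htpos : ∀ y ∈ A, 0 < t y := fun y hy =>
    sub_pos.2 ((h.mem_iff y (Metric.ball_subset_ball (by linarith) (hAδ y hy))).1 hy.2)
  have hball : ∀ y ∈ A, ∀ τ, 0 ≤ τ → τ ≤ t y → y + τ • e ∈ Metric.ball x (δ + δ) :=
    fun y hy τ h0 h1 => h.add_smul_mem_ball (hAδ y hy) (by
      rw [abs_of_nonneg h0]; exact h1.trans ((le_abs_self _).trans (htabs y hy).le))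
  set T : Eu d → Eu d := fun y => y + t y • e
  have hT : Continuous T := continuous_id.add (ht.smul continuous_const)
  have hTS : ∀ y ∈ A, T y ∈ U ∩ frontier Ω := fun y hy => by
    have hb := hball y hy (t y) (htpos y hy).le le_rfl
    exact ⟨hρU (Metric.ball_subset_ball hδρ hb),
      h.graph_mem_frontier hΩ (Metric.ball_subset_ball hδr hb)⟩
  obtain ⟨C, hC⟩ := exists_volume_cylinder_le hd h.norm_eq x (min ρ₁ δ)
  set S := U ∩ frontier Ω
  -- `T` moves points vertically onto the graph. The part of `A` that it sends into `E` lies in the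
  -- cylinder over `E ∩ S`, so no surface parametrization or area formula is needed.
  have hmap : Measure.map T (volume.restrict A) ≤
      (C : ℝ≥0∞) • (Measure.hausdorffMeasure ((d : ℝ) - 1)).restrict S := by
    refine Measure.le_iff.2 fun E hE => ?_
    rw [Measure.map_apply hT.measurable hE, Measure.restrict_apply (hT.measurable hE),
      Measure.smul_apply, Measure.restrict_apply hE, smul_eq_mul]
    refine (measure_mono ?_).trans (hC (E ∩ S))
    rintro y ⟨hyE, hyA⟩
    exact ⟨hyA.1, T y, ⟨hyE, hTS y hyA⟩, (h.proj_add_smul y (t y)).symm⟩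
  refine ⟨2 * C + 2 * (δ.toNNReal * δ.toNNReal), fun φ hφ => ?_⟩
  have h1 := setLIntegral_enorm_sq_le_along_segments hΩ.measurableSet hA ht.measurable
    h.norm_eq.le (fun y hy => (htpos y hy).le)
    (fun y hy => (le_abs_self _).trans (htabs y hy).le)
    (fun y hy τ hτ => (h.add_smul_mem_iff (Metric.ball_subset_ball hδr
      (hball y hy τ hτ.1.le hτ.2.le))).2 hτ.2) hφ
  have h2 : ∫⁻ y in A, ‖φ (y + t y • e)‖ₑ ^ 2 ≤
      C * ∫⁻ x in S, ‖φ x‖ₑ ^ 2 ∂(Measure.hausdorffMeasure ((d : ℝ) - 1)) := by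
    have hm : Measurable fun x => ‖φ x‖ₑ ^ 2 := hφ.continuous.measurable.enorm.pow_const 2
    have := lintegral_mono' hmap (le_refl fun x => ‖φ x‖ₑ ^ 2)
    rwa [lintegral_map hm hT.measurable, lintegral_smul_measure, smul_eq_mul] at this
  refine h1.trans ?_
  set E := ∫⁻ x in Ω, ‖fderiv ℝ φ x‖ₑ ^ 2
  set B := ∫⁻ x in S, ‖φ x‖ₑ ^ 2 ∂(Measure.hausdorffMeasure ((d : ℝ) - 1))
  have h3 : ENNReal.ofReal δ = (δ.toNNReal : ℝ≥0∞) := rfl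
  push_cast
  rw [h3]
  calc 2 * (∫⁻ y in A, ‖φ (y + t y • e)‖ₑ ^ 2) +
        2 * ((δ.toNNReal : ℝ≥0∞) * ((δ.toNNReal : ℝ≥0∞) * E))
      ≤ 2 * (C * (B + E)) + 2 * ((δ.toNNReal : ℝ≥0∞) * ((δ.toNNReal : ℝ≥0∞) * (B + E))) := by
        gcongr
        · exact h2.trans (by gcongr; exact le_self_add)
        · exact le_add_self
    _ = _ := by ring

/-- If points of `Ω` have controlled neighborhoods, so have boundary points. -/
theorem exists_hasLocalBound_of_interior (h : IsGraphChart Ω x e γ r) (hΩ : IsOpen Ω)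
    (hx : x ∈ frontier Ω) (H : ∀ y ∈ Ω, ∃ ρ > 0, HasLocalBound Ω S (Metric.ball y ρ)) :
    ∃ ρ > 0, HasLocalBound Ω S (Metric.ball x ρ) := by
  have hr := h.pos
  have h0 := h.height_eq_zero hΩ hx
  -- Descending by `r / 2` from any point of `Ω` near `x` stays below the graph, so a bound around
  -- this lower point can be translated back to `x`.
  have hx' : x + (-(r / 2)) • e ∈ Ω := by
    have hb := h.add_smul_mem_ball (τ := -(r / 2)) (b := r / 2)
      (Metric.mem_ball_self (half_pos hr)) (by rw [abs_neg, abs_of_pos (half_pos hr)])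
    rw [add_halves] at hb
    rw [h.add_smul_mem_iff hb, h0]
    linarith
  obtain ⟨ρ, hρ, hb⟩ := H _ hx'
  refine ⟨min ρ (r / 2), by positivity, ?_⟩
  have hseg : ∀ y ∈ Metric.ball x (min ρ (r / 2)) ∩ Ω, ∀ τ, 0 ≤ τ → τ ≤ r / 2 →
      y + τ • (-e) ∈ Ω := fun y hy τ h1 h2 => by
    rw [smul_neg, ← neg_smul]
    have hyr : y ∈ Metric.ball x (r / 2) := Metric.ball_subset_ball (min_le_right _ _) hy.1
    have hy2 := (h.mem_iff y (Metric.ball_subset_ball (by linarith) hyr)).1 hy.2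
    have hb := h.add_smul_mem_ball (τ := -τ) (b := r / 2) hyr (by rwa [abs_neg, abs_of_nonneg h1])
    rw [add_halves] at hb
    rw [h.add_smul_mem_iff hb]
    linarith
  refine hb.translate hΩ.measurableSet measurableSet_ball measurableSet_ball (e := -e)
    (by rw [norm_neg, h.norm_eq]) (half_pos hr).le (fun y hy τ hτ => hseg y hy τ hτ.1.le hτ.2.le)
    fun y hy => ⟨?_, hseg y hy _ (half_pos hr).le le_rfl⟩
  rw [Metric.mem_ball, smul_neg, ← neg_smul, dist_add_right]
  exact (Metric.mem_ball.1 hy.1).trans_le (min_le_left _ _)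

end IsGraphChart

theorem IsLipschitzDomain.exists_isGraphChart (hΩ : IsLipschitzDomain Ω) {x : Eu d}
    (hx : x ∈ frontier Ω) : ∃ e γ r, IsGraphChart Ω x e γ r := by
  obtain ⟨e, γ, K, r, h1, h2, h3, h4⟩ := hΩ.graph x hx
  exact ⟨e, γ, r, h1, h2.continuous, h3, h4⟩

/-- Connectedness: the set of points with a controlled ball is open, and it is closed relative to
`Ω` because the bound at a nearby point can be translated. -/
theorem hasLocalBound_near_interior (hΩ : IsOpen Ω) (hc : IsPreconnected Ω)
    (hne : ∃ y ∈ Ω, ∃ ρ > 0, HasLocalBound Ω S (Metric.ball y ρ)) :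
    ∀ y ∈ Ω, ∃ ρ > 0, HasLocalBound Ω S (Metric.ball y ρ) := by
  set G : Set (Eu d) := {y | ∃ ρ > 0, HasLocalBound Ω S (Metric.ball y ρ)}
  have hG : IsOpen G := by
    refine Metric.isOpen_iff.2 fun y hy => ?_
    obtain ⟨ρ, hρ, hb⟩ := hy
    refine ⟨ρ, hρ, fun z hz => ?_⟩
    obtain ⟨ε, hε, hsub⟩ := Metric.isOpen_iff.1 Metric.isOpen_ball z hz
    exact ⟨ε, hε, hb.mono hsub⟩
  refine hc.subset_of_closure_inter_subset hG hne ?_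
  rintro x ⟨hxG, hxΩ⟩
  obtain ⟨R, hR, hRΩ⟩ := Metric.isOpen_iff.1 hΩ x hxΩ
  -- `R / 2` keeps the segments inside the ball around `x`; `1` ensures `‖y - x‖ ≤ 1`, as
  -- `HasLocalBound.translate` requires.
  set ρ := min (R / 2) 1
  have hρ : 0 < ρ := by positivity
  obtain ⟨y, ⟨ρ', hρ', hb⟩, hxy⟩ := Metric.mem_closure_iff.1 hxG ρ hρ
  rw [dist_comm, dist_eq_norm] at hxy
  have hseg : ∀ z ∈ Metric.ball x (min ρ' ρ), ∀ τ : ℝ, 0 ≤ τ → τ ≤ 1 → z + τ • (y - x) ∈ Ω := by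
    intro z hz τ h0 h1
    refine hRΩ ?_
    have hz' := (Metric.mem_ball.1 hz).trans_le (min_le_right _ _)
    rw [dist_eq_norm] at hz'
    rw [Metric.mem_ball, dist_eq_norm]
    have : z + τ • (y - x) - x = (z - x) + τ • (y - x) := by abel
    rw [this]
    refine (norm_add_le _ _).trans_lt ?_
    rw [norm_smul, Real.norm_eq_abs, abs_of_nonneg h0]
    have h2 : τ * ‖y - x‖ ≤ ‖y - x‖ := mul_le_of_le_one_left (norm_nonneg _) h1
    have h3 : ρ ≤ R / 2 := min_le_left _ _
    linarith
  refine ⟨min ρ' ρ, by positivity, hb.translate hΩ.measurableSet measurableSet_ball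
    measurableSet_ball (e := y - x) (hxy.le.trans (min_le_right _ _)) zero_le_one
    (fun z hz τ hτ => hseg z hz.1 τ hτ.1.le hτ.2.le)
    fun z hz => ⟨?_, hseg z hz.1 1 zero_le_one le_rfl⟩⟩
  rw [Metric.mem_ball, dist_eq_norm, one_smul]
  have : z + (y - x) - y = z - x := by abel
  rw [this, ← dist_eq_norm]
  exact (Metric.mem_ball.1 hz.1).trans_le (min_le_left _ _)

/-- Friedrichs' inequality for smooth functions, with a boundary term on a part of the boundary. -/
theorem IsLipschitzDomain.exists_lintegral_sq_le (hd : 1 ≤ d) (hΩ : IsLipschitzDomain Ω)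
    (hS : ∃ U, IsOpen U ∧ S = U ∩ frontier Ω) (hne : S.Nonempty) :
    ∃ C : ℝ≥0, ∀ φ : Eu d → ℝ, ContDiff ℝ ∞ φ →
      ∫⁻ x in Ω, ‖φ x‖ₑ ^ 2 ≤
        C * ((∫⁻ x in S, ‖φ x‖ₑ ^ 2 ∂(Measure.hausdorffMeasure ((d : ℝ) - 1))) +
          ∫⁻ x in Ω, ‖fderiv ℝ φ x‖ₑ ^ 2) := by
  obtain ⟨U, hU, rfl⟩ := hS
  obtain ⟨x₀, hx₀⟩ := hne
  have hstart : ∃ y ∈ Ω, ∃ ρ > 0, HasLocalBound Ω (U ∩ frontier Ω) (Metric.ball y ρ) := by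
    obtain ⟨e, γ, r, hch⟩ := hΩ.exists_isGraphChart hx₀.2
    obtain ⟨ρ, hρ, hb⟩ := hch.exists_hasLocalBound hd hΩ.isOpen hU hx₀
    obtain ⟨y, hy, hyx⟩ := Metric.mem_closure_iff.1 (frontier_subset_closure hx₀.2) ρ hρ
    rw [dist_comm] at hyx
    obtain ⟨ε, hε, hsub⟩ := Metric.isOpen_iff.1 Metric.isOpen_ball y (Metric.mem_ball.2 hyx)
    exact ⟨y, hy, ε, hε, hb.mono hsub⟩
  have hint := hasLocalBound_near_interior hΩ.isOpen hΩ.isConnected.isPreconnected hstart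
  have hcl : ∀ x ∈ closure Ω, ∃ ρ > 0, HasLocalBound Ω (U ∩ frontier Ω) (Metric.ball x ρ) := by
    intro x hx
    by_cases hxΩ : x ∈ Ω
    · exact hint x hxΩ
    · have hxf : x ∈ frontier Ω := by
        rw [hΩ.isOpen.frontier_eq]
        exact ⟨hx, hxΩ⟩
      obtain ⟨e, γ, r, hch⟩ := hΩ.exists_isGraphChart hxf
      exact hch.exists_hasLocalBound_of_interior hΩ.isOpen hxf hint
  -- `HasLocalBound` is stable under subsets and finite unions, so compactness of the closure makes
  -- it global.
  have hall : HasLocalBound Ω (U ∩ frontier Ω) (closure Ω) := by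
    refine hΩ.isBounded.isCompact_closure.induction_on hasLocalBound_empty
      (fun s t hst ht => ht.mono hst) (fun s t hs ht => hs.union ht) fun x hx => ?_
    obtain ⟨ρ, hρ, hb⟩ := hcl x hx
    exact ⟨_, mem_nhdsWithin_of_mem_nhds (Metric.ball_mem_nhds x hρ), hb⟩
  obtain ⟨C, hC⟩ := hall
  exact ⟨C, fun φ hφ => by simpa only [inter_eq_right.2 subset_closure] using hC φ hφ⟩

theorem norm_fderiv_sq_le (φ : Eu d → ℝ) (x : Eu d) :
    ‖fderiv ℝ φ x‖ ^ 2 ≤ ∑ i : Fin d, partialD i φ x ^ 2 := by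
  have h0 : 0 ≤ ∑ i : Fin d, partialD i φ x ^ 2 := Finset.sum_nonneg fun i _ => sq_nonneg _
  refine (Real.le_sqrt (norm_nonneg _) h0).1 ?_
  refine ContinuousLinearMap.opNorm_le_bound _ (Real.sqrt_nonneg _) fun v => ?_
  have hv : fderiv ℝ φ x v = ∑ i : Fin d, v i * partialD i φ x := by
    conv_lhs => rw [← (EuclideanSpace.basisFun (Fin d) ℝ).sum_repr v]
    simp [partialD]
  rw [hv, Real.norm_eq_abs, EuclideanSpace.norm_eq, ← Real.sqrt_mul h0]
  refine Real.abs_le_sqrt ?_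
  rw [mul_comm]
  simpa using Finset.sum_mul_sq_le_sq_mul_sq Finset.univ (fun i => v i) fun i => partialD i φ x

theorem lintegral_enorm_fderiv_sq_le (hΩ : Bornology.IsBounded Ω) {φ : Eu d → ℝ}
    (hφ : ContDiff ℝ ∞ φ) :
    ∫⁻ x in Ω, ‖fderiv ℝ φ x‖ₑ ^ 2 ≤
      ENNReal.ofReal (∑ i : Fin d, normL2 Ω (partialD i φ) ^ 2) := by
  have hm : ∀ i : Fin d, MemL2 Ω (partialD i φ) := fun i =>
    memL2_of_continuous hΩ (partialD_contDiff hφ i).continuous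
  have hi := integrable_finsetSum Finset.univ fun i _ => (hm i).integrable_sq
  simp only [normL2_sq]
  rw [← integral_finsetSum _ fun i _ => (hm i).integrable_sq,
    ofReal_integral_eq_lintegral_ofReal hi
      (ae_of_all _ fun x => Finset.sum_nonneg fun i _ => sq_nonneg _)]
  refine lintegral_mono fun x => ?_
  rw [← ofReal_norm, ← ENNReal.ofReal_pow (norm_nonneg _)]
  exact ENNReal.ofReal_le_ofReal (norm_fderiv_sq_le φ x)

/-- Replaces the gradient of an approximant by the Dirichlet energy of `v` and an error that
vanishes along the approximating sequence. -/
theorem MemH1.sum_normL2_partialD_le (hΩ : IsOpen Ω) (hb : Bornology.IsBounded Ω) {v φ : Eu d → ℝ}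
    (hv : MemH1 Ω v) (hφ : ContDiff ℝ ∞ φ) :
    ∑ i : Fin d, normL2 Ω (partialD i φ) ^ 2 ≤
      2 * normH1 Ω (fun x => φ x - v x) ^ 2 + 2 * dirichlet Ω v v := by
  have hφ1 := memH1_of_contDiff hb hφ
  have hw := hφ1.sub hv
  have h1 : ∀ i : Fin d, normL2 Ω (partialD i φ) ^ 2 ≤
      2 * normL2 Ω (weakPartial Ω i fun x => φ x - v x) ^ 2 +
        2 * normL2 Ω (weakPartial Ω i v) ^ 2 := fun i => by
    refine le_trans (le_of_eq ?_)
      (normL2_sq_add_le (hw.weakPartial_spec i).1 (hv.weakPartial_spec i).1)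
    congr 1
    refine normL2_congr ?_
    filter_upwards [weakPartial_sub_ae hΩ hφ1 hv i,
      (hasWeakPartial_of_contDiff hφ i).weakPartial_ae hΩ
        (memL2_of_continuous hb (partialD_contDiff hφ i).continuous)] with x hx hx'
    rw [hx, hx']
    ring
  refine (Finset.sum_le_sum fun i _ => h1 i).trans ?_
  rw [Finset.sum_add_distrib, ← Finset.mul_sum, ← Finset.mul_sum, hw.normH1_sq,
    hw.dirichlet_self, hv.dirichlet_self]
  have := sq_nonneg (normL2 Ω fun x => φ x - v x)
  linarith

/-- Friedrichs' inequality for functions with vanishing trace on a part of the boundary. -/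
theorem IsLipschitzDomain.exists_friedrichs (hd : 1 ≤ d) (hΩ : IsLipschitzDomain Ω)
    (hS : ∃ U, IsOpen U ∧ S = U ∩ frontier Ω) (hne : S.Nonempty) :
    ∃ C : ℝ, 0 < C ∧ ∀ v, MemV0 Ω S v → normL2 Ω v ^ 2 ≤ C * dirichlet Ω v v := by
  obtain ⟨C, hC⟩ := hΩ.exists_lintegral_sq_le hd hS hne
  -- The limit yields `4 * C`; the `+ 1` only secures positivity.
  refine ⟨4 * C + 1, by positivity, fun v hv => ?_⟩
  obtain ⟨hv1, φ, hφ, hlim, htr⟩ := hv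
  set D := dirichlet Ω v v
  have hD : 0 ≤ D := dirichlet_self_nonneg v
  set a : ℕ → ℝ := fun n => normH1 Ω fun x => φ n x - v x
  set B : ℕ → ℝ≥0∞ := fun n => eLpNorm (fun x => φ n x - (fun _ => 0) x) 2
    ((Measure.hausdorffMeasure ((d : ℝ) - 1)).restrict S)
  have hB : ∀ n, ∫⁻ x in S, ‖φ n x‖ₑ ^ 2 ∂(Measure.hausdorffMeasure ((d : ℝ) - 1)) = B n ^ 2 := by
    intro n
    simp only [B, sub_zero]
    rw [eLpNorm_eq_lintegral_rpow_enorm_toReal (by norm_num) (by norm_num), ← ENNReal.rpow_natCast,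
      ← ENNReal.rpow_mul]
    norm_num
  -- Stated in `ℝ≥0∞`, so the boundary norms need not be finite. Both `a n` and `B n` tend to `0`,
  -- and only the term in `D` survives the limit.
  have key : ∀ n, ENNReal.ofReal (normL2 Ω v ^ 2) ≤
      2 * ENNReal.ofReal (a n ^ 2) +
        2 * (C * (B n ^ 2 + ENNReal.ofReal (2 * a n ^ 2 + 2 * D))) := by
    intro n
    have hφ1 := memH1_of_contDiff hΩ.isBounded (hφ n)
    have hw := hφ1.sub hv1
    have e1 : normL2 Ω v ^ 2 ≤ 2 * a n ^ 2 + 2 * normL2 Ω (φ n) ^ 2 := by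
      have h2 : normL2 Ω (fun x => (-1) * (φ n x - v x)) ^ 2 ≤ a n ^ 2 := by
        rw [normL2_const_mul_sq, hw.normH1_sq]
        have := dirichlet_self_nonneg (Ω := Ω) fun x => φ n x - v x
        linarith
      have h3 := normL2_sq_add_le (hw.1.const_mul (-1)) hφ1.1
      have h4 : (fun x => (-1) * (φ n x - v x) + φ n x) = v := funext fun x => by ring
      rw [h4] at h3
      linarith
    have e2 := hC (φ n) (hφ n)
    rw [lintegral_enorm_sq_eq hφ1.1, hB] at e2
    refine (ENNReal.ofReal_le_ofReal e1).trans ?_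
    rw [ENNReal.ofReal_add (by positivity) (by positivity), ENNReal.ofReal_mul (by norm_num),
      ENNReal.ofReal_mul (by norm_num), ENNReal.ofReal_ofNat]
    gcongr
    refine e2.trans ?_
    gcongr
    exact (lintegral_enorm_fderiv_sq_le hΩ.isBounded (hφ n)).trans
      (ENNReal.ofReal_le_ofReal (hv1.sum_normL2_partialD_le hΩ.isOpen hΩ.isBounded (hφ n)))
  have ha2 : Tendsto (fun n => a n ^ 2) atTop (𝓝 0) := by simpa using hlim.pow 2
  have hB2 : Tendsto (fun n => B n ^ 2) atTop (𝓝 0) := by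
    simpa [Function.comp_def] using ((ENNReal.continuous_pow 2).tendsto 0).comp htr
  have l1 : Tendsto (fun n => ENNReal.ofReal (a n ^ 2)) atTop (𝓝 0) := by
    simpa [Function.comp_def] using (ENNReal.continuous_ofReal.tendsto 0).comp ha2
  have l2 : Tendsto (fun n => ENNReal.ofReal (2 * a n ^ 2 + 2 * D)) atTop
      (𝓝 (ENNReal.ofReal (2 * D))) := by
    have : Tendsto (fun n => 2 * a n ^ 2 + 2 * D) atTop (𝓝 (2 * D)) := by
      simpa using (ha2.const_mul 2).add_const (2 * D)
    exact (ENNReal.continuous_ofReal.tendsto _).comp this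
  have l3 := (ENNReal.Tendsto.const_mul (a := 2) l1 (Or.inr (by simp))).add
    (ENNReal.Tendsto.const_mul (a := 2) (ENNReal.Tendsto.const_mul (a := (C : ℝ≥0∞)) (hB2.add l2)
      (Or.inr (by simp))) (Or.inr (by simp)))
  have hle := ge_of_tendsto' l3 key
  rw [mul_zero, zero_add, zero_add] at hle
  have hfin : 2 * ((C : ℝ≥0∞) * ENNReal.ofReal (2 * D)) = ENNReal.ofReal (4 * C * D) := by
    have : (4 * C * D : ℝ) = 2 * (C * (2 * D)) := by ring
    rw [this, ENNReal.ofReal_mul (q := C * (2 * D)) zero_le_two, ENNReal.ofReal_mul (NNReal.coe_nonneg C),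
      ENNReal.ofReal_ofNat, ENNReal.ofReal_coe_nnreal]
  rw [hfin, ENNReal.ofReal_le_ofReal_iff (by positivity)] at hle
  linarith

end Poincare

/-! ### Second derivatives on the whole space through Bessel potentials. -/

section WholeSpace
open TemperedDistribution FourierTransform LineDeriv
open scoped SchwartzMap LineDeriv Laplacian

variable {E : Type*} [NormedAddCommGroup E] [InnerProductSpace ℝ E] [FiniteDimensional ℝ E]
  [MeasurableSpace E] [BorelSpace E]

/-- The symbol is `1 + ‖x‖²`, while with this Fourier normalization `Δ` has symbol `-(2π)² ‖x‖²`;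
hence the constant. -/
theorem besselPotential_two_eq (f : 𝓢'(E, ℂ)) :
    besselPotential E ℂ 2 f = f - ((2 * Real.pi) ^ 2)⁻¹ • Δ f := by
  have h1 : (fun x : E => (((1 + ‖x‖ ^ 2) ^ ((2 : ℝ) / 2) : ℝ) : ℂ)) =
      (fun _ => (1 : ℂ)) + fun x => ((‖x‖ ^ 2 : ℝ) : ℂ) := by
    ext x; simp
  have hpi : (2 * Real.pi) ^ 2 ≠ 0 := by positivity
  rw [besselPotential, h1, laplacian_eq_fourierMultiplierCLM, neg_smul, smul_neg, sub_neg_eq_add,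
    smul_smul, inv_mul_cancel₀ hpi, one_smul,
    fourierMultiplierCLM_apply, smulLeftCLM_add (by fun_prop) (by fun_prop)]
  simp [fourierMultiplierCLM_apply]

theorem coe_Lp_injective {f g : Lp ℂ 2 (volume : Measure E)}
    (h : (f : 𝓢'(E, ℂ)) = (g : 𝓢'(E, ℂ))) : f = g :=
  LinearMap.ker_eq_bot.1 (Lp.ker_toTemperedDistributionCLM_eq_bot (F := ℂ) (μ := volume) (p := 2)) h

/-- Second derivatives of `(1 - c Δ)⁻¹ h` are bounded in `L²` by `h`. -/
theorem exists_lineDeriv_bessel_bound (m₁ m₂ : E) :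
    ∃ A : Lp ℂ 2 (volume : Measure E) →L[ℂ] Lp ℂ 2 (volume : Measure E),
      ∀ h : Lp ℂ 2 (volume : Measure E),
        ∂_{m₁} (∂_{m₂} (besselPotential E ℂ (-2) (h : 𝓢'(E, ℂ)))) = (A h : 𝓢'(E, ℂ)) := by
  set ι := Lp.toTemperedDistributionCLM ℂ (volume : Measure E) 2
  let D : 𝓢'(E, ℂ) →L[ℂ] 𝓢'(E, ℂ) :=
    lineDerivOpCLM ℂ 𝓢'(E, ℂ) m₁ ∘L lineDerivOpCLM ℂ 𝓢'(E, ℂ) m₂ ∘L besselPotential E ℂ (-2)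
  have hex : ∀ h : Lp ℂ 2 (volume : Measure E), ∃ g : Lp ℂ 2 (volume : Measure E),
      D (ι h) = ι g := by
    intro h
    have h2 : MemSobolev 2 2 (besselPotential E ℂ (-2) (h : 𝓢'(E, ℂ))) := ⟨h, by simp⟩
    have h0 := (h2.lineDerivOp (m := m₂)).lineDerivOp (m := m₁)
    norm_num at h0
    exact memSobolev_zero_iff.1 h0
  choose a ha using hex
  let A : Lp ℂ 2 (volume : Measure E) →ₗ[ℂ] Lp ℂ 2 (volume : Measure E) :=
    { toFun := a
      map_add' := fun x y => coe_Lp_injective (by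
        change ι _ = ι _
        rw [← ha, map_add, map_add, map_add, ha, ha])
      map_smul' := fun c x => coe_Lp_injective (by
        change ι _ = ι _
        rw [← ha, map_smul, map_smul, map_smul, ha]; rfl) }
  -- Closed graph theorem: `D` and `ι` are continuous into tempered distributions, where limits are
  -- unique and `ι` is injective.
  have hA : Continuous A := by
    refine A.continuous_of_seq_closed_graph fun u x y hu hy => coe_Lp_injective ?_
    change ι y = ι (a x)
    have h1 : Tendsto (fun n => ι (a (u n))) atTop (𝓝 (ι y)) := (ι.continuous.tendsto y).comp hy
    have h2 : Tendsto (fun n => D (ι (u n))) atTop (𝓝 (D (ι x))) :=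
      ((D.continuous.comp ι.continuous).tendsto x).comp hu
    simp_rw [ha] at h2
    exact tendsto_nhds_unique h1 h2
  exact ⟨⟨A, hA⟩, fun h => ha h⟩

/-- If `ΔW = F`, then `W = (1 - c Δ)⁻¹ (W - c F)` with `c = (2π)⁻²`, and the bounded operator `A`
applies to `W - c F`. -/
theorem exists_lineDeriv_bound_of_laplacian (m₁ m₂ : E) :
    ∃ C : ℝ, 0 ≤ C ∧ ∀ W F : Lp ℂ 2 (volume : Measure E), Δ (W : 𝓢'(E, ℂ)) = (F : 𝓢'(E, ℂ)) →
      ∃ G : Lp ℂ 2 (volume : Measure E), ∂_{m₁} (∂_{m₂} (W : 𝓢'(E, ℂ))) = (G : 𝓢'(E, ℂ)) ∧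
        ‖G‖ ≤ C * (‖W‖ + ‖F‖) := by
  obtain ⟨A, hA⟩ := exists_lineDeriv_bessel_bound m₁ m₂
  set c : ℝ := ((2 * Real.pi) ^ 2)⁻¹
  refine ⟨‖A‖ * (1 + |c|), by positivity, fun W F h => ⟨A (W - (c : ℂ) • F), ?_, ?_⟩⟩
  · rw [← hA]
    congr 2
    have h1 : ((W - (c : ℂ) • F : Lp ℂ 2 (volume : Measure E)) : 𝓢'(E, ℂ)) =
        besselPotential E ℂ 2 (W : 𝓢'(E, ℂ)) := by
      rw [besselPotential_two_eq, h]
      change Lp.toTemperedDistributionCLM ℂ (volume : Measure E) 2 _ = _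
      rw [map_sub, map_smul]
      rfl
    rw [h1]
    simp
  · refine (A.le_opNorm _).trans ?_
    rw [mul_assoc]
    gcongr
    refine (norm_sub_le _ _).trans ?_
    rw [norm_smul, Complex.norm_real, Real.norm_eq_abs]
    nlinarith [norm_nonneg W, norm_nonneg F, abs_nonneg c]

end WholeSpace

/-! ### Interior `H²` regularity by cutoff. -/

section Regularity
open TemperedDistribution LineDeriv
open scoped SchwartzMap LineDeriv Laplacian

variable {Ω : Set (Eu d)} {v w g F : Eu d → ℝ}

/-- Tempered distributions act here on complex functions; taking `L` to be the real or imaginary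
part returns to real ones. -/
theorem partialD_clm_comp (L : ℂ →L[ℝ] ℝ) (ψ : 𝓢(Eu d, ℂ)) (i : Fin d) :
    partialD i (fun x => L (ψ x)) =
      fun x => L ((∂_{(EuclideanSpace.single i 1 : Eu d)} ψ : 𝓢(Eu d, ℂ)) x) := by
  ext x
  rw [SchwartzMap.lineDerivOp_apply_eq_fderiv, partialD]
  change fderiv ℝ (L ∘ ψ) x _ = _
  rw [fderiv_comp x L.differentiableAt ψ.differentiableAt, ContinuousLinearMap.fderiv]
  rfl

theorem laplacian_clm_comp (L : ℂ →L[ℝ] ℝ) (ψ : 𝓢(Eu d, ℂ)) (x : Eu d) :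
    ∑ i : Fin d, partialD i (partialD i (fun x => L (ψ x))) x = L ((Δ ψ : 𝓢(Eu d, ℂ)) x) := by
  rw [SchwartzMap.laplacian_eq_sum (EuclideanSpace.basisFun (Fin d) ℝ) ψ]
  simp only [partialD_clm_comp, EuclideanSpace.basisFun_apply]
  rw [sum_apply, map_sum]

theorem MemL2.memLp_ofReal (hΩ : IsOpen Ω) (hv : MemL2 Ω v) (h0 : ∀ x, x ∉ Ω → v x = 0) :
    MemLp (fun x => (v x : ℂ)) 2 (volume : Measure (Eu d)) := by
  have h1 : Ω.indicator v = v := indicator_eq_self.2 fun x hx => by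
    by_contra h; exact hx (h0 x h)
  have h2 : MemLp v 2 (volume : Measure (Eu d)) := by
    rw [← h1]
    exact (memLp_indicator_iff_restrict hΩ.measurableSet).2 hv
  exact h2.ofReal

theorem MemL2.norm_toLp_ofReal (hΩ : IsOpen Ω) (hv : MemL2 Ω v) (h0 : ∀ x, x ∉ Ω → v x = 0) :
    ‖(hv.memLp_ofReal hΩ h0).toLp‖ = normL2 Ω v := by
  have h1 : Ω.indicator v = v := indicator_eq_self.2 fun x hx => by
    by_contra h; exact hx (h0 x h)
  rw [Lp.norm_toLp, normL2_eq_toReal hv, ← eLpNorm_indicator_eq_eLpNorm_restrict hΩ.measurableSet,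
    h1]
  congr 1
  exact eLpNorm_congr_norm_ae (ae_of_all _ fun x => by simp)

theorem clm_toTemperedDistribution_apply (L : ℂ →L[ℝ] ℝ) (W : Lp ℂ 2 (volume : Measure (Eu d)))
    (ψ : 𝓢(Eu d, ℂ)) :
    L ((W : 𝓢'(Eu d, ℂ)) ψ) = ∫ x, L (ψ x * W x) := by
  rw [Lp.toTemperedDistribution_apply]
  refine (L.integral_comp_comm ?_).symm
  exact MemLp.integrable_mul (p := 2) (q := 2) (ψ.memLp 2 volume) (Lp.memLp W)

theorem MemL2.clm_toTemperedDistribution_apply (hΩ : IsOpen Ω) (hv : MemL2 Ω v)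
    (h0 : ∀ x, x ∉ Ω → v x = 0) (L : ℂ →L[ℝ] ℝ) (ψ : 𝓢(Eu d, ℂ)) :
    L (((hv.memLp_ofReal hΩ h0).toLp : 𝓢'(Eu d, ℂ)) ψ) = ∫ x in Ω, v x * L (ψ x) := by
  have h1 : ∀ x, x ∉ Ω → v x * L (ψ x) = 0 := fun x hx => by rw [h0 x hx, zero_mul]
  rw [QuasiRev.clm_toTemperedDistribution_apply, setIntegral_eq_integral_of_forall_compl_eq_zero h1]
  refine integral_congr_ae ((hv.memLp_ofReal hΩ h0).coeFn_toLp.mono fun x hx => ?_)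
  simp only [hx]
  rw [mul_comm, ← Complex.real_smul, map_smul, smul_eq_mul]

/-- A square integrable function with square integrable Laplacian on the whole space has square
integrable second derivatives. -/
theorem exists_second_derivative (hΩ : IsOpen Ω) (i j : Fin d) :
    ∃ C : ℝ, 0 ≤ C ∧ ∀ v F : Eu d → ℝ, MemL2 Ω v → MemL2 Ω F →
      (∀ x, x ∉ Ω → v x = 0) → (∀ x, x ∉ Ω → F x = 0) →
      (∀ ψ : Eu d → ℝ, ContDiff ℝ ∞ ψ →
        ∫ x in Ω, v x * (∑ i : Fin d, partialD i (partialD i ψ) x) = ∫ x in Ω, F x * ψ x) →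
      ∃ G, MemL2 Ω G ∧ normL2 Ω G ≤ C * (normL2 Ω v + normL2 Ω F) ∧
        ∀ φ, IsTestFun Ω φ →
          ∫ x in Ω, v x * partialD i (partialD j φ) x = ∫ x in Ω, G x * φ x := by
  -- The directions appear as `j`, `i` because moving the derivatives onto the test function
  -- reverses their order.
  obtain ⟨C, hC, H⟩ := exists_lineDeriv_bound_of_laplacian
    (EuclideanSpace.single j 1 : Eu d) (EuclideanSpace.single i 1 : Eu d)
  refine ⟨C, hC, fun v F hv hF hv0 hF0 hΔ => ?_⟩
  obtain ⟨G, hG, hGn⟩ := H (hv.memLp_ofReal hΩ hv0).toLp (hF.memLp_ofReal hΩ hF0).toLp (by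
    ext ψ
    rw [laplacian_apply_apply]
    have key : ∀ L : ℂ →L[ℝ] ℝ,
        L (((hv.memLp_ofReal hΩ hv0).toLp : 𝓢'(Eu d, ℂ)) (Δ ψ)) =
          L (((hF.memLp_ofReal hΩ hF0).toLp : 𝓢'(Eu d, ℂ)) ψ) := fun L => by
      -- The real and imaginary parts of a Schwartz function need not have compact support; for this
      -- reason the hypothesis admits every smooth `ψ`.
      have e := hΔ (fun x => L (ψ x)) (L.contDiff.comp (ψ.smooth ⊤))
      simp only [laplacian_clm_comp] at e
      rw [hv.clm_toTemperedDistribution_apply hΩ hv0, hF.clm_toTemperedDistribution_apply hΩ hF0, e]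
    exact Complex.ext (key Complex.reCLM) (key Complex.imCLM))
  rw [hv.norm_toLp_ofReal hΩ hv0, hF.norm_toLp_ofReal hΩ hF0] at hGn
  have hGre : MemLp (fun x => (G x).re) 2 (volume : Measure (Eu d)) := (Lp.memLp G).re
  have hGm : MemL2 Ω fun x => (G x).re := hGre.restrict Ω
  refine ⟨fun x => (G x).re, hGm, le_trans ?_ hGn, fun φ hφ => ?_⟩
  · rw [normL2_eq_toReal hGm, Lp.norm_def]
    refine ENNReal.toReal_mono (Lp.eLpNorm_ne_top G) ?_
    refine (eLpNorm_mono_measure _ Measure.restrict_le_self).trans ?_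
    exact eLpNorm_mono fun x => by simpa using Complex.abs_re_le_norm (G x)
  · have hc : HasCompactSupport fun x => (φ x : ℂ) := hφ.compact.comp_left (g := Complex.ofReal) rfl
    have hs : ContDiff ℝ ∞ fun x => (φ x : ℂ) := Complex.ofRealCLM.contDiff.comp hφ.smooth
    set ψ : 𝓢(Eu d, ℂ) := hc.toSchwartzMap hs
    have hψ : ∀ x, Complex.reCLM (ψ x) = φ x := fun x => Complex.ofReal_re _
    have h1 := congrArg (fun T : 𝓢'(Eu d, ℂ) => Complex.reCLM (T ψ)) hG
    simp only [lineDerivOp_apply_apply] at h1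
    rw [hv.clm_toTemperedDistribution_apply hΩ hv0, QuasiRev.clm_toTemperedDistribution_apply] at h1
    have h2 : ∀ x, Complex.reCLM ((-∂_{(EuclideanSpace.single i 1 : Eu d)}
        (-∂_{(EuclideanSpace.single j 1 : Eu d)} ψ) : 𝓢(Eu d, ℂ)) x) =
        partialD i (partialD j φ) x := fun x => by
      have e1 : φ = fun x => Complex.reCLM (ψ x) := funext fun x => (hψ x).symm
      rw [e1, partialD_clm_comp, partialD_clm_comp]
      simp [lineDerivOp_neg]
    simp only [h2] at h1
    have h3 : ∀ x, x ∉ Ω → (G x).re * φ x = 0 := fun x hx => by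
      rw [hφ.eq_zero_of_notMem hx, mul_zero]
    rw [h1, setIntegral_eq_integral_of_forall_compl_eq_zero h3]
    refine integral_congr_ae (ae_of_all _ fun x => ?_)
    change ((φ x : ℂ) * G x).re = _
    rw [Complex.re_ofReal_mul, mul_comm]

/-- The Laplacian of `ζ w`. -/
noncomputable def cutoffLaplacian (Ω : Set (Eu d)) (ζ w g : Eu d → ℝ) : Eu d → ℝ := fun x =>
  ζ x * g x + ((∑ i : Fin d, 2 * (partialD i ζ x * weakPartial Ω i w x)) +
    (∑ i : Fin d, partialD i (partialD i ζ) x) * w x)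

theorem IsTestFun.laplacian {ζ : Eu d → ℝ} (hζ : IsTestFun Ω ζ) :
    IsTestFun Ω (fun x => ∑ i : Fin d, QuasiRev.partialD i (QuasiRev.partialD i ζ) x) where
  smooth := ContDiff.sum fun i _ => ((hζ.partialD i).partialD i).smooth
  compact := by
    refine hζ.compact.mono' fun x hx => ?_
    by_contra h
    refine hx (Finset.sum_eq_zero fun i _ => image_eq_zero_of_notMem_tsupport fun h2 => h ?_)
    exact tsupport_partialD_subset _ _ (tsupport_partialD_subset _ _ h2)
  support := by
    refine (closure_minimal (fun x hx => ?_) (isClosed_tsupport ζ)).trans hζ.support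
    by_contra h
    refine hx (Finset.sum_eq_zero fun i _ => image_eq_zero_of_notMem_tsupport fun h2 => h ?_)
    exact tsupport_partialD_subset _ _ (tsupport_partialD_subset _ _ h2)

theorem MemH1.memL2_gradient_term {ζ : Eu d → ℝ} (hζ : IsTestFun Ω ζ) (hw : MemH1 Ω w) :
    MemL2 Ω fun x => ∑ i : Fin d, 2 * (partialD i ζ x * weakPartial Ω i w x) :=
  memLp_finsetSum _ fun i _ =>
    ((hζ.partialD i).mul_memL2 (hw.weakPartial_spec i).1).const_mul 2

theorem MemH1.memL2_cutoffLaplacian {ζ : Eu d → ℝ} (hζ : IsTestFun Ω ζ) (hw : MemH1 Ω w)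
    (hg : MemL2 Ω g) : MemL2 Ω (cutoffLaplacian Ω ζ w g) :=
  (hζ.mul_memL2 hg).add ((hw.memL2_gradient_term hζ).add (hζ.laplacian.mul_memL2 hw.1))

theorem integral_add_add {α : Type*} [MeasurableSpace α] {μ : Measure α} {f₁ f₂ f₃ : α → ℝ}
    (h₁ : Integrable f₁ μ) (h₂ : Integrable f₂ μ) (h₃ : Integrable f₃ μ) :
    ∫ x, f₁ x + (f₂ x + f₃ x) ∂μ = ∫ x, f₁ x ∂μ + (∫ x, f₂ x ∂μ + ∫ x, f₃ x ∂μ) := by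
  rw [← integral_add h₂ h₃]
  exact integral_add h₁ (h₂.add h₃)

/-- Uses `ζ Δψ = Δ(ζψ) - 2 ∑ ∂_i(ψ ∂_i ζ) + ψ Δζ`. The cutoff makes `ζψ` and `ψ ∂_i ζ` test
functions, so the weak Laplacian and the weak gradient of `w` suffice, and `ψ` needs no compact
support. -/
theorem MemH1.integral_cutoffLaplacian {ζ : Eu d → ℝ} (hζ : IsTestFun Ω ζ) (hw : MemH1 Ω w)
    (hg : MemL2 Ω g) (hΔ : HasWeakLaplacian Ω w g) {ψ : Eu d → ℝ} (hψ : ContDiff ℝ ∞ ψ) :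
    ∫ x in Ω, ζ x * w x * (∑ i : Fin d, partialD i (partialD i ψ) x) =
      ∫ x in Ω, cutoffLaplacian Ω ζ w g x * ψ x := by
  have t1 : ∀ i, IsTestFun Ω (fun x => partialD i ζ x * ψ x) := fun i =>
    (hζ.partialD i).mul_right hψ
  have hT : IsTestFun Ω (fun x => ζ x * ψ x) := hζ.mul_right hψ
  have e1 : ∀ i x, partialD i (partialD i fun x => ζ x * ψ x) x =
      ζ x * partialD i (partialD i ψ) x + 2 * partialD i (fun x => partialD i ζ x * ψ x) x -
        partialD i (partialD i ζ) x * ψ x := fun i x => by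
    have : partialD i (fun x => ζ x * ψ x) =
        fun x => partialD i ζ x * ψ x + ζ x * partialD i ψ x :=
      funext fun x => partialD_mul hζ.smooth hψ i x
    rw [this]
    have h2 : partialD i (fun x => partialD i ζ x * ψ x + ζ x * partialD i ψ x) x =
        partialD i (fun x => partialD i ζ x * ψ x) x +
          partialD i (fun x => ζ x * partialD i ψ x) x := by
      have a1 := ((t1 i).smooth.differentiable (by simp)) x
      have a2 := ((hζ.smooth.mul (partialD_contDiff hψ i)).differentiable (by simp)) x
      unfold partialD at a1 a2 ⊢
      rw [fderiv_fun_add a1 a2]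
      rfl
    rw [h2, partialD_mul hζ.smooth (partialD_contDiff hψ i),
      partialD_mul (partialD_contDiff hζ.smooth i) hψ]
    ring
  have e2 : ∀ x, ζ x * w x * (∑ i : Fin d, partialD i (partialD i ψ) x) =
      w x * (∑ i : Fin d, partialD i (partialD i fun x => ζ x * ψ x) x) +
        ((∑ i : Fin d, (-2) * (w x * partialD i (fun x => partialD i ζ x * ψ x) x)) +
          w x * ((∑ i : Fin d, partialD i (partialD i ζ) x) * ψ x)) := fun x => by
    simp only [e1, Finset.sum_add_distrib, Finset.sum_sub_distrib, ← Finset.mul_sum,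
      ← Finset.sum_mul]
    ring
  have i1 := hw.1.integrable_mul hT.laplacian.memL2
  have i2 : ∀ i, Integrable (fun x => (-2) * (w x * partialD i (fun x => partialD i ζ x * ψ x) x))
      (volume.restrict Ω) := fun i => (hw.1.integrable_mul ((t1 i).partialD i).memL2).const_mul _
  have i3 := hw.1.integrable_mul (hζ.laplacian.mul_right hψ).memL2
  have j1 := hg.integrable_mul hT.memL2
  have j2 : ∀ i, Integrable (fun x => 2 * (weakPartial Ω i w x * (partialD i ζ x * ψ x)))
      (volume.restrict Ω) :=
    fun i => ((hw.weakPartial_spec i).1.integrable_mul (t1 i).memL2).const_mul _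
  have e3 : ∀ x, cutoffLaplacian Ω ζ w g x * ψ x = g x * (ζ x * ψ x) +
      ((∑ i : Fin d, 2 * (weakPartial Ω i w x * (partialD i ζ x * ψ x))) +
        w x * ((∑ i : Fin d, partialD i (partialD i ζ) x) * ψ x)) := fun x => by
    have : ∑ i : Fin d, 2 * (weakPartial Ω i w x * (partialD i ζ x * ψ x)) =
        (∑ i : Fin d, 2 * (partialD i ζ x * weakPartial Ω i w x)) * ψ x := by
      rw [Finset.sum_mul]
      exact Finset.sum_congr rfl fun i _ => by ring
    rw [this, cutoffLaplacian]
    ring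
  have i4 := integrable_finsetSum Finset.univ fun i _ => i2 i
  have j4 := integrable_finsetSum Finset.univ fun i _ => j2 i
  simp only [e2, e3]
  rw [integral_add_add i1 i4 i3, integral_add_add j1 j4 i3,
    integral_finsetSum _ fun i _ => i2 i, integral_finsetSum _ fun i _ => j2 i, hΔ _ hT]
  congr 2
  refine Finset.sum_congr rfl fun i _ => ?_
  rw [integral_const_mul, integral_const_mul, (hw.weakPartial_spec i).2 _ (t1 i)]
  ring

theorem normL2_sum_sq_le (s : Finset (Fin d)) {f : Fin d → Eu d → ℝ} (hf : ∀ i, MemL2 Ω (f i)) :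
    normL2 Ω (fun x => ∑ i ∈ s, f i x) ^ 2 ≤ s.card * ∑ i ∈ s, normL2 Ω (f i) ^ 2 := by
  have h : MemL2 Ω fun x => ∑ i ∈ s, f i x := memLp_finsetSum _ fun i _ => hf i
  simp only [normL2_sq]
  rw [← integral_finsetSum _ fun i _ => (hf i).integrable_sq, ← integral_const_mul]
  exact integral_mono h.integrable_sq
    ((integrable_finsetSum _ fun i _ => (hf i).integrable_sq).const_mul _)
    fun x => sq_sum_le_card_mul_sum_sq

theorem exists_cutoffLaplacian_bound {ζ : Eu d → ℝ} (hζ : IsTestFun Ω ζ) :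
    ∃ C : ℝ, 0 ≤ C ∧ ∀ w g, MemH1 Ω w → MemL2 Ω g →
      normL2 Ω (cutoffLaplacian Ω ζ w g) ^ 2 ≤
        C * (normL2 Ω w ^ 2 + dirichlet Ω w w + normL2 Ω g ^ 2) := by
  obtain ⟨A, hA, hA'⟩ := hζ.exists_normL2_mul_le
  obtain ⟨B, hB, hB'⟩ := hζ.laplacian.exists_normL2_mul_le
  choose D hD hD' using fun i => (hζ.partialD i).exists_normL2_mul_le
  set S := ∑ i, D i
  have hS : 0 ≤ S := Finset.sum_nonneg fun i _ => hD i
  refine ⟨2 * A + 16 * d * S + 4 * B, by positivity, fun w g hw hg => ?_⟩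
  have m1 := hw.memL2_gradient_term hζ
  have m2 := hζ.laplacian.mul_memL2 hw.1
  have h1 := normL2_sq_add_le (hζ.mul_memL2 hg) (m1.add m2)
  have h2 := normL2_sq_add_le m1 m2
  have h3 := hA' g hg
  have h4 := hB' w hw.1
  have h5 := normL2_sum_sq_le Finset.univ fun i =>
    ((hζ.partialD i).mul_memL2 (hw.weakPartial_spec i).1).const_mul 2
  have h6 : ∑ i, normL2 Ω (fun x => 2 * (partialD i ζ x * weakPartial Ω i w x)) ^ 2 ≤
      4 * S * dirichlet Ω w w := by
    rw [hw.dirichlet_self, Finset.mul_sum]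
    refine Finset.sum_le_sum fun i _ => ?_
    rw [normL2_const_mul_sq]
    have h7 := hD' i _ (hw.weakPartial_spec i).1
    have h8 : D i ≤ S := Finset.single_le_sum (fun i _ => hD i) (Finset.mem_univ i)
    have h9 := mul_le_mul_of_nonneg_right h8 (sq_nonneg (normL2 Ω (weakPartial Ω i w)))
    linarith
  rw [Finset.card_univ, Fintype.card_fin] at h5
  have h10 := mul_le_mul_of_nonneg_left h6 (Nat.cast_nonneg (α := ℝ) d)
  have hd := dirichlet_self_nonneg (Ω := Ω) w
  have p1 := sq_nonneg (normL2 Ω w)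
  have p2 := sq_nonneg (normL2 Ω g)
  have p3 : (0 : ℝ) ≤ d * S := by positivity
  have q1 := mul_nonneg hA p1
  have q2 := mul_nonneg hA hd
  have q3 := mul_nonneg p3 p1
  have q4 := mul_nonneg p3 p2
  have q5 := mul_nonneg hB hd
  have q6 := mul_nonneg hB p2
  have q7 := mul_nonneg p3 hd
  change normL2 Ω (cutoffLaplacian Ω ζ w g) ^ 2 ≤ _ at h1
  nlinarith

/-- Interior `H²` regularity. -/
theorem exists_interior_regularity (hΩ : IsOpen Ω) {ζ : Eu d → ℝ} (hζ : IsTestFun Ω ζ) :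
    ∃ C : ℝ, 0 ≤ C ∧ ∀ w g, MemH1 Ω w → MemL2 Ω g → HasWeakLaplacian Ω w g →
      MemH2 Ω (fun x => ζ x * w x) ∧
      normH2 Ω (fun x => ζ x * w x) ^ 2 ≤
        C * (normL2 Ω w ^ 2 + dirichlet Ω w w + normL2 Ω g ^ 2) := by
  obtain ⟨A, hA, hA'⟩ := hζ.exists_normL2_mul_le
  choose D hD hD' using fun i => (hζ.partialD i).exists_normL2_mul_le
  obtain ⟨K, hK, hK'⟩ := exists_cutoffLaplacian_bound hζ
  choose B hB hB' using fun i j : Fin d => exists_second_derivative hΩ i j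
  set SB := ∑ i, ∑ j, B j i ^ 2
  set SD := ∑ i, D i
  have hSD : 0 ≤ SD := Finset.sum_nonneg fun i _ => hD i
  have hSB : 0 ≤ SB := Finset.sum_nonneg fun i _ => Finset.sum_nonneg fun j _ => sq_nonneg _
  refine ⟨A + (2 * d * A + 2 * SD) + SB * (2 * (A + K)), by positivity,
    fun w g hw hg hΔ => ?_⟩
  have h0 : ∀ x, x ∉ Ω → ζ x * w x = 0 := fun x hx => by
    rw [hζ.eq_zero_of_notMem hx, zero_mul]
  have hF0 : ∀ x, x ∉ Ω → cutoffLaplacian Ω ζ w g x = 0 := fun x hx => by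
    simp [cutoffLaplacian, hζ.eq_zero_of_notMem hx, (hζ.partialD _).eq_zero_of_notMem hx,
      ((hζ.partialD _).partialD _).eq_zero_of_notMem hx]
  have mF := hw.memL2_cutoffLaplacian hζ hg
  have mv := hζ.mul_memL2 hw.1
  have m1 : ∀ i, MemL2 Ω fun x => ζ x * weakPartial Ω i w x + partialD i ζ x * w x := fun i =>
    (hζ.mul_memL2 (hw.weakPartial_spec i).1).add ((hζ.partialD i).mul_memL2 hw.1)
  have p1 : ∀ i, HasWeakPartial Ω i (fun x => ζ x * w x)
      (fun x => ζ x * weakPartial Ω i w x + partialD i ζ x * w x) := fun i =>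
    HasWeakPartial.test_mul hζ hw.1 (hw.weakPartial_spec i).1 (hw.weakPartial_spec i).2
  have hv : MemH1 Ω (fun x => ζ x * w x) := ⟨mv, fun i => ⟨_, m1 i, p1 i⟩⟩
  choose G hG hGn hGp using fun i j => hB' i j _ _ mv mF h0 hF0
    (fun ψ hψ => hw.integral_cutoffLaplacian hζ hg hΔ hψ)
  -- Testing `∂_i (ζ w)` with `∂_j φ` moves both derivatives onto `φ`, where `G i j` represents the
  -- result.
  have p2 : ∀ i j, HasWeakPartial Ω j (weakPartial Ω i fun x => ζ x * w x) (G i j) :=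
    fun i j φ hφ => by
      rw [← hGp i j φ hφ, (hv.weakPartial_spec i).2 _ (hφ.partialD j), neg_neg]
  refine ⟨⟨hv, fun i => ⟨(hv.weakPartial_spec i).1, fun j => ⟨_, hG i j, p2 i j⟩⟩⟩, ?_⟩
  have n0 := hA' w hw.1
  have hd := dirichlet_self_nonneg (Ω := Ω) w
  have w0 := sq_nonneg (normL2 Ω w)
  have g0 := sq_nonneg (normL2 Ω g)
  set N := normL2 Ω w ^ 2 + dirichlet Ω w w + normL2 Ω g ^ 2
  have hN : 0 ≤ N := by positivity
  have hwN : normL2 Ω w ^ 2 ≤ N := by linarith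
  have hdN : dirichlet Ω w w ≤ N := by linarith
  have nv : normL2 Ω (fun x => ζ x * w x) ^ 2 ≤ A * N :=
    n0.trans (mul_le_mul_of_nonneg_left hwN hA)
  have n1 : ∑ i, normL2 Ω (weakPartial Ω i fun x => ζ x * w x) ^ 2 ≤ (2 * d * A + 2 * SD) * N := by
    have : ∀ i, normL2 Ω (weakPartial Ω i fun x => ζ x * w x) ^ 2 ≤ 2 * (A * N) + 2 * D i * N := by
      intro i
      rw [normL2_congr ((p1 i).weakPartial_ae hΩ (m1 i))]
      have a1 := normL2_sq_add_le (hζ.mul_memL2 (hw.weakPartial_spec i).1)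
        ((hζ.partialD i).mul_memL2 hw.1)
      have a2 := hA' _ (hw.weakPartial_spec i).1
      have a3 := hD' i w hw.1
      have a4 : normL2 Ω (weakPartial Ω i w) ^ 2 ≤ N := by
        refine le_trans ?_ hdN
        rw [hw.dirichlet_self]
        exact Finset.single_le_sum (f := fun i => normL2 Ω (weakPartial Ω i w) ^ 2)
          (fun i _ => sq_nonneg _) (Finset.mem_univ i)
      have a5 := mul_le_mul_of_nonneg_left a4 hA
      have a6 := mul_le_mul_of_nonneg_left hwN (hD i)
      linarith
    refine (Finset.sum_le_sum fun i _ => this i).trans (le_of_eq ?_)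
    rw [Finset.sum_add_distrib, Finset.sum_const, Finset.card_univ, Fintype.card_fin,
      ← Finset.sum_mul, ← Finset.mul_sum, nsmul_eq_mul]
    ring
  have nF := hK' w g hw hg
  have n2 : ∑ i, ∑ j, normL2 Ω (weakPartial Ω j (weakPartial Ω i fun x => ζ x * w x)) ^ 2 ≤
      SB * (2 * (A + K)) * N := by
    rw [mul_assoc, Finset.sum_comm, Finset.sum_mul]
    refine Finset.sum_le_sum fun i _ => ?_
    rw [Finset.sum_mul]
    refine Finset.sum_le_sum fun j _ => ?_
    rw [normL2_congr ((p2 j i).weakPartial_ae hΩ (hG j i))]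
    have b1 := pow_le_pow_left₀ (normL2_nonneg _) (hGn j i) 2
    rw [mul_pow] at b1
    refine b1.trans (mul_le_mul_of_nonneg_left ?_ (sq_nonneg _))
    have b2 := sq_nonneg (normL2 Ω (fun x => ζ x * w x) - normL2 Ω (cutoffLaplacian Ω ζ w g))
    nlinarith
  rw [normH2, Real.sq_sqrt (by positivity)]
  linarith

end Regularity

/-! ### Interior equations and energy estimates for quasi-reversibility. -/

section Energy

variable {Ω Γ Γ' S : Set (Eu d)} {f u l : Eu d → ℝ} {ε : ℝ}

theorem normH1_sub_self (hΩ : IsOpen Ω) {v : Eu d → ℝ} (hv : MemH1 Ω v) :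
    normH1 Ω (fun x => v x - v x) = 0 := by
  have h0 : normL2 Ω (fun _ => (0 : ℝ)) = 0 := by simp [normL2]
  have h1 : ∀ i : Fin d, normL2 Ω (weakPartial Ω i fun x => v x - v x) = 0 := fun i => by
    rw [normL2_congr (weakPartial_sub_ae hΩ hv hv i)]
    simpa using h0
  have h2 : normL2 Ω (fun x => v x - v x) = 0 := by simpa using h0
  rw [normH1, h2]
  simp only [h1]
  simp

/-- Test functions vanish on the frontier since `Ω` is open, so a constant approximating sequence
works. Both variational equations can thus be tested with them. -/
theorem IsTestFun.memV0 (hΩ : IsOpen Ω) (hS : ∃ U, IsOpen U ∧ S = U ∩ frontier Ω)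
    {φ : Eu d → ℝ} (hφ : IsTestFun Ω φ) : MemV0 Ω S φ := by
  obtain ⟨U, hU, rfl⟩ := hS
  refine ⟨hφ.memH1, fun _ => φ, fun _ => hφ.smooth, ?_, ?_⟩
  · simp only [normH1_sub_self hΩ hφ.memH1, tendsto_const_nhds]
  · have h0 : eLpNorm (fun x => φ x - 0) 2
        ((Measure.hausdorffMeasure ((d : ℝ) - 1)).restrict (U ∩ frontier Ω)) = 0 := by
      have hm : MeasurableSet (U ∩ frontier Ω) :=
        hU.measurableSet.inter isClosed_frontier.measurableSet
      have : (fun x => φ x - 0) =ᵐ[(Measure.hausdorffMeasure ((d : ℝ) - 1)).restrict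
          (U ∩ frontier Ω)] 0 := by
        filter_upwards [ae_restrict_mem hm] with x hx
        rw [hΩ.frontier_eq] at hx
        simp [hφ.eq_zero_of_notMem hx.2.2]
      rw [eLpNorm_congr_ae this, eLpNorm_zero]
    simp only [h0, tendsto_const_nhds]

namespace IsQRSolution

theorem dirichlet_test (h : IsQRSolution Ω Γ Γ' f ε u l) (hΩ : IsOpen Ω)
    (hΓ : IsBoundaryPartition Ω Γ Γ') {φ : Eu d → ℝ} (hφ : IsTestFun Ω φ) :
    (1 + ε) * dirichlet Ω u φ = ∫ x in Ω, f x * φ x := by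
  have h1 := h.eq_left φ (hφ.memV0 hΩ hΓ.relOpen_left)
  have h2 := h.eq_right φ (hφ.memV0 hΩ hΓ.relOpen_right)
  rw [dirichlet_comm φ l] at h1
  linarith

theorem hasWeakLaplacian_left (h : IsQRSolution Ω Γ Γ' f ε u l) (hΩ : IsOpen Ω)
    (hΓ : IsBoundaryPartition Ω Γ Γ') (hε : 0 < ε) :
    HasWeakLaplacian Ω u (fun x => (-(1 + ε)⁻¹) * f x) := fun φ hφ => by
  have h1 := h.dirichlet_test hΩ hΓ hφ
  have h2 : (1 + ε) ≠ 0 := by positivity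
  rw [h.mem_left.1.integral_mul_laplacian hΩ hφ]
  simp only [mul_assoc]
  rw [integral_const_mul, ← h1]
  field_simp

theorem hasWeakLaplacian_right (h : IsQRSolution Ω Γ Γ' f ε u l) (hΩ : IsOpen Ω)
    (hΓ : IsBoundaryPartition Ω Γ Γ') (hε : 0 < ε) :
    HasWeakLaplacian Ω l (fun x => (ε * (1 + ε)⁻¹) * f x) := fun φ hφ => by
  have h1 := h.dirichlet_test hΩ hΓ hφ
  have h2 : (1 + ε) ≠ 0 := by positivity
  have h3 := h.eq_left φ (hφ.memV0 hΩ hΓ.relOpen_left)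
  rw [dirichlet_comm φ l] at h3
  rw [h.mem_right.1.integral_mul_laplacian hΩ hφ]
  have h4 : ∀ x, ε * (1 + ε)⁻¹ * f x * φ x = (ε * (1 + ε)⁻¹) * (f x * φ x) := fun x => by ring
  simp only [h4]
  rw [integral_const_mul, ← h1]
  field_simp
  linarith

theorem energy_identity (h : IsQRSolution Ω Γ Γ' f ε u l) :
    ε * dirichlet Ω u u + dirichlet Ω l l = -∫ x in Ω, f x * l x := by
  linarith [h.eq_left u h.mem_left, h.eq_right l h.mem_right]

/-- Young's inequality on `-∫ f l`, weighted by the Friedrichs constant `P` so that half of the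
Dirichlet energy of `l` absorbs the `l` term. -/
theorem energy_le (h : IsQRSolution Ω Γ Γ' f ε u l) (hf : MemL2 Ω f) {P : ℝ} (hP : 0 < P)
    (hl : normL2 Ω l ^ 2 ≤ P * dirichlet Ω l l) :
    ε * dirichlet Ω u u + dirichlet Ω l l / 2 ≤ P / 2 * normL2 Ω f ^ 2 := by
  have h1 := h.energy_identity
  have hl2 := h.mem_right.1.1
  have h2 : -∫ x in Ω, f x * l x ≤ P / 2 * normL2 Ω f ^ 2 + 1 / (2 * P) * normL2 Ω l ^ 2 := by
    rw [normL2_sq, normL2_sq, ← integral_const_mul, ← integral_const_mul, ← integral_neg,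
      ← integral_add (hf.integrable_sq.const_mul _) (hl2.integrable_sq.const_mul _)]
    refine integral_mono (hf.integrable_mul hl2).neg
      ((hf.integrable_sq.const_mul _).add (hl2.integrable_sq.const_mul _)) fun x => ?_
    have h3 : 0 ≤ (P * f x + l x) ^ 2 / (2 * P) := by positivity
    have h4 : (P * f x + l x) ^ 2 / (2 * P) =
        P / 2 * f x ^ 2 + 1 / (2 * P) * l x ^ 2 + f x * l x := by
      field_simp
      ring
    change -(f x * l x) ≤ P / 2 * f x ^ 2 + 1 / (2 * P) * l x ^ 2
    linarith
  have h5 : 1 / (2 * P) * normL2 Ω l ^ 2 ≤ dirichlet Ω l l / 2 := by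
    refine (mul_le_mul_of_nonneg_left hl (by positivity)).trans (le_of_eq ?_)
    field_simp
  linarith

/-- Energy estimate when the Cauchy problem has a solution `w`. -/
theorem energy_le_of_cauchy (h : IsQRSolution Ω Γ Γ' f ε u l) (hε : 0 < ε) (hΩ : IsOpen Ω)
    (hf : MemL2 Ω f) {w : Eu d → ℝ} (hw : IsCauchySolution Ω Γ Γ' f w) :
    ε * dirichlet Ω u u + 2 * dirichlet Ω l l ≤ ε * dirichlet Ω w w := by
  have hfn : MemL2 Ω fun x => -f x := hf.neg
  -- The Neumann condition gives `∫ ∇w · ∇l = ∫ f l`. With the equations tested by `u`, `w` and `l`,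
  -- this yields `ε ‖∇u‖² + ‖∇l‖² = ε ∫ ∇u · ∇w`; Young's inequality finishes.
  have h1 := hw.normal_zero l h.mem_right
  have h2 : ∫ x in Ω, weakLaplacian Ω w x * l x = -∫ x in Ω, f x * l x := by
    rw [← integral_neg]
    refine integral_congr_ae ((hw.laplace.weakLaplacian_ae hΩ hfn).mono fun x hx => ?_)
    simp only [hx, neg_mul]
  rw [normalDerivPairing, h2] at h1
  have h3 := h.eq_left u h.mem_left
  have h4 := h.eq_left w ⟨hw.memH1, hw.trace_zero⟩
  have h5 := h.eq_right l h.mem_right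
  have h6 := mul_le_mul_of_nonneg_left (h.mem_left.1.two_mul_dirichlet_le hw.memH1) hε.le
  linarith

end IsQRSolution

theorem IsCauchySolution.normH1Delta_sq (hΩ : IsOpen Ω) (hf : MemL2 Ω f) {w : Eu d → ℝ}
    (hw : IsCauchySolution Ω Γ Γ' f w) :
    normH1Delta Ω w ^ 2 = normL2 Ω w ^ 2 + dirichlet Ω w w + normL2 Ω f ^ 2 := by
  have hfn : MemL2 Ω fun x => -f x := hf.neg
  rw [normH1Delta, Real.sq_sqrt (by positivity), hw.memH1.normH1_sq,
    normL2_congr (hw.laplace.weakLaplacian_ae hΩ hfn), normL2_sq (fun x => -f x), normL2_sq f]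
  simp only [neg_sq]

end Energy

end QuasiRev

/-! ### Combination of regularity, Friedrichs and energy estimates. -/

theorem proposition2p1 (d : ℕ) (hd : 2 ≤ d) (Ω Γ Γ' : Set (QuasiRev.Eu d))
    (hΩ : QuasiRev.IsLipschitzDomain Ω) (hΓ : QuasiRev.IsBoundaryPartition Ω Γ Γ')
    (ζ : QuasiRev.Eu d → ℝ) (hζ : QuasiRev.IsTestFun Ω ζ) :
    (∀ f, QuasiRev.MemL2 Ω f → ∀ ε : ℝ, 0 < ε → ∀ u l, QuasiRev.IsQRSolution Ω Γ Γ' f ε u l →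
      QuasiRev.MemH2 Ω (fun x => ζ x * u x) ∧ QuasiRev.MemH2 Ω (fun x => ζ x * l x)) ∧
    ∃ C : ℝ, 0 < C ∧ ∀ f, QuasiRev.MemL2 Ω f →
      (∀ ε : ℝ, 0 < ε → ε ≤ 1 → ∀ uε lε, QuasiRev.IsQRSolution Ω Γ Γ' f ε uε lε →
        √ε * QuasiRev.normH2 Ω (fun x => ζ x * uε x) + QuasiRev.normH2 Ω (fun x => ζ x * lε x)
          ≤ C * QuasiRev.normL2 Ω f) ∧
      (∀ u, QuasiRev.IsCauchySolution Ω Γ Γ' f u →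
        ∀ ε : ℝ, 0 < ε → ε ≤ 1 → ∀ uε lε, QuasiRev.IsQRSolution Ω Γ Γ' f ε uε lε →
          QuasiRev.normH2 Ω (fun x => ζ x * uε x)
              + QuasiRev.normH2 Ω (fun x => ζ x * lε x) / √ε
            ≤ C * QuasiRev.normH1Delta Ω u) := by
  obtain ⟨R, hR, hreg⟩ := QuasiRev.exists_interior_regularity hΩ.isOpen hζ
  obtain ⟨P₁, hP₁, hf₁⟩ := hΩ.exists_friedrichs (by omega) hΓ.relOpen_left hΓ.nonempty_left
  obtain ⟨P₂, hP₂, hf₂⟩ := hΩ.exists_friedrichs (by omega) hΓ.relOpen_right hΓ.nonempty_right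
  refine ⟨fun f hf ε hε u l h => ⟨?_, ?_⟩, ?_⟩
  · exact (hreg u _ h.mem_left.1 (hf.const_mul _)
      (h.hasWeakLaplacian_left hΩ.isOpen hΓ hε)).1
  · exact (hreg l _ h.mem_right.1 (hf.const_mul _)
      (h.hasWeakLaplacian_right hΩ.isOpen hΓ hε)).1
  have hregu : ∀ f, QuasiRev.MemL2 Ω f → ∀ ε : ℝ, 0 < ε → ∀ u l,
      QuasiRev.IsQRSolution Ω Γ Γ' f ε u l →
      QuasiRev.normH2 Ω (fun x => ζ x * u x) ^ 2 ≤
        R * ((P₁ + 1) * QuasiRev.dirichlet Ω u u + QuasiRev.normL2 Ω f ^ 2) := by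
    intro f hf ε hε u l h
    refine (hreg u _ h.mem_left.1 (hf.const_mul _)
      (h.hasWeakLaplacian_left hΩ.isOpen hΓ hε)).2.trans (mul_le_mul_of_nonneg_left ?_ hR)
    rw [QuasiRev.normL2_const_mul_sq, neg_sq]
    have h1 : (1 + ε)⁻¹ ^ 2 ≤ 1 :=
      pow_le_one₀ (by positivity) (inv_le_one_of_one_le₀ (by linarith))
    have h2 := mul_le_mul_of_nonneg_right h1 (sq_nonneg (QuasiRev.normL2 Ω f))
    linarith [hf₁ u h.mem_left]
  have hregl : ∀ f, QuasiRev.MemL2 Ω f → ∀ ε : ℝ, 0 < ε → ε ≤ 1 → ∀ u l,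
      QuasiRev.IsQRSolution Ω Γ Γ' f ε u l →
      QuasiRev.normH2 Ω (fun x => ζ x * l x) ^ 2 ≤
        R * ((P₂ + 1) * QuasiRev.dirichlet Ω l l + ε * QuasiRev.normL2 Ω f ^ 2) := by
    intro f hf ε hε hε1 u l h
    refine (hreg l _ h.mem_right.1 (hf.const_mul _)
      (h.hasWeakLaplacian_right hΩ.isOpen hΓ hε)).2.trans (mul_le_mul_of_nonneg_left ?_ hR)
    rw [QuasiRev.normL2_const_mul_sq, mul_pow]
    have h1 : (1 + ε)⁻¹ ^ 2 ≤ 1 :=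
      pow_le_one₀ (by positivity) (inv_le_one_of_one_le₀ (by linarith))
    -- Here `ε ≤ 1` is needed. The factor `ε` that remains on `‖f‖²` allows the division by `√ε` in
    -- the second estimate.
    have h2 : ε ^ 2 * (1 + ε)⁻¹ ^ 2 ≤ ε :=
      (mul_le_of_le_one_right (sq_nonneg ε) h1).trans (by nlinarith)
    have h3 := mul_le_mul_of_nonneg_right h2 (sq_nonneg (QuasiRev.normL2 Ω f))
    linarith [hf₂ l h.mem_right]
  -- One constant for all four squared bounds: the first product serves `u`, the second `l`, the
  -- inner `1` the term in `f`. The final `+ 1` gives positivity, and the factor `2` in front of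
  -- `√K` accounts for summing two norms.
  set K := R * ((P₁ + 1) * (P₂ + 1) + (P₂ + 1) * (P₂ + 1) + 1) + 1
  have hK : 0 < K := by positivity
  refine ⟨2 * √K, by positivity, fun f hf => ⟨fun ε hε hε1 u l h => ?_,
    fun w hw ε hε hε1 u l h => ?_⟩⟩
  · have hE := h.energy_le hf hP₂ (hf₂ l h.mem_right)
    have du := mul_nonneg hε.le (QuasiRev.dirichlet_self_nonneg (Ω := Ω) u)
    have dl := QuasiRev.dirichlet_self_nonneg (Ω := Ω) l
    have hN := sq_nonneg (QuasiRev.normL2 Ω f)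
    have a1 : √ε * QuasiRev.normH2 Ω (fun x => ζ x * u x) ≤ √K * QuasiRev.normL2 Ω f := by
      refine le_of_sq_le_sq ?_ (mul_nonneg (Real.sqrt_nonneg _) (QuasiRev.normL2_nonneg f))
      rw [mul_pow, mul_pow, Real.sq_sqrt hε.le, Real.sq_sqrt hK.le]
      have b1 := mul_le_mul_of_nonneg_left (hregu f hf ε hε u l h) hε.le
      have b2 : ε * ((P₁ + 1) * QuasiRev.dirichlet Ω u u + QuasiRev.normL2 Ω f ^ 2) ≤
          ((P₁ + 1) * (P₂ + 1) + 1) * QuasiRev.normL2 Ω f ^ 2 := by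
        have c1 : ε * QuasiRev.dirichlet Ω u u ≤ (P₂ + 1) * QuasiRev.normL2 Ω f ^ 2 := by nlinarith
        have c2 := mul_le_mul_of_nonneg_left c1 (by positivity : 0 ≤ P₁ + 1)
        have c3 := mul_le_mul_of_nonneg_right hε1 hN
        linarith
      have b3 := mul_le_mul_of_nonneg_left b2 hR
      have b4 : 0 ≤ R * ((P₂ + 1) * (P₂ + 1)) * QuasiRev.normL2 Ω f ^ 2 := by positivity
      simp only [K]
      linarith
    have a2 : QuasiRev.normH2 Ω (fun x => ζ x * l x) ≤ √K * QuasiRev.normL2 Ω f := by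
      refine le_of_sq_le_sq ?_ (mul_nonneg (Real.sqrt_nonneg _) (QuasiRev.normL2_nonneg f))
      rw [mul_pow, Real.sq_sqrt hK.le]
      have b1 := hregl f hf ε hε hε1 u l h
      have b2 : (P₂ + 1) * QuasiRev.dirichlet Ω l l + ε * QuasiRev.normL2 Ω f ^ 2 ≤
          ((P₂ + 1) * (P₂ + 1) + 1) * QuasiRev.normL2 Ω f ^ 2 := by
        have c1 : QuasiRev.dirichlet Ω l l ≤ (P₂ + 1) * QuasiRev.normL2 Ω f ^ 2 := by nlinarith
        have c2 := mul_le_mul_of_nonneg_left c1 (by positivity : 0 ≤ P₂ + 1)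
        have c3 := mul_le_mul_of_nonneg_right hε1 hN
        linarith
      have b3 := mul_le_mul_of_nonneg_left b2 hR
      have b4 : 0 ≤ R * ((P₁ + 1) * (P₂ + 1)) * QuasiRev.normL2 Ω f ^ 2 := by positivity
      simp only [K]
      linarith
    linarith
  · have hE := h.energy_le_of_cauchy hε hΩ.isOpen hf hw
    have hM := hw.normH1Delta_sq hΩ.isOpen hf
    set M := QuasiRev.normH1Delta Ω w
    have hM0 : 0 ≤ M := Real.sqrt_nonneg _
    have du := QuasiRev.dirichlet_self_nonneg (Ω := Ω) u
    have dl := QuasiRev.dirichlet_self_nonneg (Ω := Ω) l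
    have dw := QuasiRev.dirichlet_self_nonneg (Ω := Ω) w
    have hN := sq_nonneg (QuasiRev.normL2 Ω f)
    have hw2 := sq_nonneg (QuasiRev.normL2 Ω w)
    have hsε : 0 < √ε := Real.sqrt_pos.2 hε
    have a1 : QuasiRev.normH2 Ω (fun x => ζ x * u x) ≤ √K * M := by
      refine le_of_sq_le_sq ?_ (mul_nonneg (Real.sqrt_nonneg _) hM0)
      rw [mul_pow, Real.sq_sqrt hK.le]
      have b1 := hregu f hf ε hε u l h
      have c0 : QuasiRev.dirichlet Ω u u ≤ QuasiRev.dirichlet Ω w w :=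
        le_of_mul_le_mul_left (by linarith) hε
      have b2 : (P₁ + 1) * QuasiRev.dirichlet Ω u u + QuasiRev.normL2 Ω f ^ 2 ≤
          ((P₁ + 1) * (P₂ + 1) + 1) * M ^ 2 := by
        have c2 := mul_le_mul_of_nonneg_left (by linarith : QuasiRev.dirichlet Ω u u ≤ M ^ 2)
          (by positivity : 0 ≤ P₁ + 1)
        have c3 : 0 ≤ (P₁ + 1) * P₂ * M ^ 2 := by positivity
        linarith
      have b3 := mul_le_mul_of_nonneg_left b2 hR
      have b4 : 0 ≤ R * ((P₂ + 1) * (P₂ + 1)) * M ^ 2 := by positivity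
      simp only [K]
      nlinarith [sq_nonneg M]
    have a2 : QuasiRev.normH2 Ω (fun x => ζ x * l x) / √ε ≤ √K * M := by
      rw [div_le_iff₀ hsε]
      refine le_of_sq_le_sq ?_ (by positivity)
      rw [mul_pow, mul_pow, Real.sq_sqrt hK.le, Real.sq_sqrt hε.le]
      have b1 := hregl f hf ε hε hε1 u l h
      have hεM := mul_le_mul_of_nonneg_left
        (by linarith : QuasiRev.dirichlet Ω w w ≤ M ^ 2) hε.le
      have hεu := mul_nonneg hε.le du
      have b2 : (P₂ + 1) * QuasiRev.dirichlet Ω l l + ε * QuasiRev.normL2 Ω f ^ 2 ≤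
          ((P₂ + 1) * (P₂ + 1) + 1) * (M ^ 2 * ε) := by
        have c2 := mul_le_mul_of_nonneg_left
          (by linarith : QuasiRev.dirichlet Ω l l ≤ M ^ 2 * ε) (by positivity : 0 ≤ P₂ + 1)
        have c3 := mul_le_mul_of_nonneg_left
          (by linarith : QuasiRev.normL2 Ω f ^ 2 ≤ M ^ 2) hε.le
        have c4 : 0 ≤ (P₂ + 1) * P₂ * (M ^ 2 * ε) := by positivity
        linarith
      have b3 := mul_le_mul_of_nonneg_left b2 hR
      have b4 : 0 ≤ R * ((P₁ + 1) * (P₂ + 1)) * (M ^ 2 * ε) := by positivity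
      have b5 : 0 ≤ M ^ 2 * ε := by positivity
      simp only [K]
      linarith
    linarith
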